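/- Let $\varphi:[0,\infty)\to[0,\infty)$ be continuous and strictly increasing, and put $W(x)=\exp(\varphi(|x|))$, $x\in\mathbb R$. Suppose that $\lim_{|t|\to\infty} t^k/W(t)=0$ for every $k\in\mathbb N$ and that $\int_{-\infty}^{\infty}\frac{\log W(t)}{1+t^2}\,dt=\infty$. Suppose moreover that $\varphi$ is regularly growing, that is, for some $A>0$ at least one of the following holds: - (normal growth) on $[A,\infty)$ the function $\varphi(x)/x^2$ is decreasing (not necessarily strictly) and $\varphi(x)$ is a convex function of $\log x$; - (rapid growth) for some $\varepsilon>0$ the function $\varphi(x)/x^{1+\varepsilon}$ is increasing (not necessarily strictly) on $[A,\infty)$. For $f:\mathbb R\to\mathbb C$ let $\|f\|_{p,W}=\left(\int_{\mathbb R}|f(x)/W(x)|^p\,dx\right)^{1/p}$ if $1\le p<\infty$, and $\|f\|_{\infty,W}=\sup_{x\in\mathbb R}|f(x)/W(x)|$. For $n\ge 1$ let $$E_n(p,W)=\inf_{Q}\left\|\frac1{x-i}-Q(x)\right\|_{p,W},$$ where $Q$ runs over the polynomials with complex coefficients of degree at most $n-1$, and let $$I_n=\int_0^1\min\left(\varphi\left(\tfrac1x\right),n\right)dx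 .$$ Then $\log E_n(p,W)\simeq -I_n$ for every $p\in[1,\infty]$, in the following sense. 1. There are $C>0$ and $N\in\mathbb N$, depending only on $\varphi$, such that for all $p\in[1,\infty]$ and all $n\ge N$ one has $0<E_n(p,W)<1$ and $$-C\,I_n\le \log E_n(p,W)\le -C^{-1}I_n .$$ 2. For every $p\in[1,\infty]$ there is $C>0$, depending only on $\varphi$ and $p$, such that for all $n\ge1$ one has $E_n(p,W)>0$, and the two inequalities of part 1 hold whenever $E_n(p,W)<1$. -/

import Mathlib

open MeasureTheory Set Filter Topology
open scoped ENNReal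

namespace WeightedApprox

noncomputable section

/-- The weight `W(x) = exp (φ(|x|))` on the real line; only the values of `φ` on `[0, ∞)` matter. -/
def weight (φ : ℝ → ℝ) (x : ℝ) : ℝ := Real.exp (φ |x|)

/-- `φ` is a nonnegative continuous strictly increasing function on `[0, ∞)` and
`W = exp (φ(|x|))` grows faster than every polynomial and has divergent logarithmic integral. -/
structure IsWeightExponent (φ : ℝ → ℝ) : Prop where
  nonneg : ∀ x, 0 ≤ x → 0 ≤ φ x
  continuousOn : ContinuousOn φ (Ici 0)
  strictMonoOn : StrictMonoOn φ (Ici 0)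
  growth : ∀ n : ℕ, Tendsto (fun t : ℝ => t ^ n / weight φ t) (cocompact ℝ) (𝓝 0)
  log_integral : ∫⁻ t : ℝ, ENNReal.ofReal (Real.log (weight φ t) / (1 + t ^ 2)) = ∞

/-- On some `[A, ∞)`, `A > 0`, the quotient `φ(x) / x²` is decreasing and `φ(x)` is a convex
function of `log x`. -/
def NormallyGrowing (φ : ℝ → ℝ) : Prop :=
  ∃ A : ℝ, 0 < A ∧ AntitoneOn (fun x => φ x / x ^ 2) (Ici A) ∧
    ConvexOn ℝ (Ici (Real.log A)) (fun t => φ (Real.exp t))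

/-- For some `ε > 0` the quotient `φ(x) / x^(1+ε)` is increasing on some `[A, ∞)`, `A > 0`. -/
def RapidlyGrowing (φ : ℝ → ℝ) : Prop :=
  ∃ ε : ℝ, 0 < ε ∧ ∃ A : ℝ, 0 < A ∧ MonotoneOn (fun x => φ x / x ^ (1 + ε)) (Ici A)

def RegularlyGrowing (φ : ℝ → ℝ) : Prop := NormallyGrowing φ ∨ RapidlyGrowing φ

/-- The weighted norm `‖f‖_{p,W}`: the `L^p` norm (with respect to Lebesgue measure) of `f / W` for
`p < ∞`, and the supremum of `|f / W|` for `p = ∞`. -/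
def weightedNorm (p : ℝ≥0∞) (W : ℝ → ℝ) (f : ℝ → ℂ) : ℝ≥0∞ :=
  if p = ∞ then ⨆ x : ℝ, ‖f x / (W x : ℂ)‖ₑ
  else eLpNorm (fun x : ℝ => f x / (W x : ℂ)) p volume

/-- `E_n(p, W)`: the error of approximating `1 / (x - i)` by complex polynomials of degree at most
`n - 1` in the norm `‖·‖_{p,W}`. -/
def cauchyError (p : ℝ≥0∞) (W : ℝ → ℝ) (n : ℕ) : ℝ≥0∞ :=
  ⨅ Q ∈ Polynomial.degreeLT ℂ n,
    weightedNorm p W (fun x : ℝ => 1 / ((x : ℂ) - Complex.I) - Q.eval (x : ℂ))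

/-- `∫_0^1 min (φ(1/x), n) dx`. -/
def truncatedIntegral (φ : ℝ → ℝ) (n : ℕ) : ℝ :=
  ∫ x in (0 : ℝ)..1, min (φ (1 / x)) (n : ℝ)

end

end WeightedApprox

/-! The polynomials `P = 1 - (z - i) Q` are exactly those of degree at most `n` with `P(i) = 1`, and
`1 / (x - i) - Q = P / (x - i)` on the line. So `E_n` measures how large `|P(i)|` can be for a `P`
of degree `n` controlled by `W` on the real line, and both bounds are extremal estimates at `i`.

Lower bound (`exists_cauchyError_ge`; no regularity needed). Map the disc to the complement of `[-R,
R]` by Joukowski, with `φ(R) ≈ n`. Apply Cauchy's formula to `ζ ^ n P`, damped by `exp(-h)`, where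
`Re h` dominates `φ` on the circle up to a constant. The loss at the preimage of `i` is `O(n / R)`
from the degree and `O(∑ φ(2^k) / 2^k)`, over `2^k ≤ R`, from the weight
(`norm_eval_I_le_integral`). Both are `O(I_n)` by dyadic splitting of `I_n`.

Upper bound (`exists_cauchyError_le`). It suffices to have `P` of degree at most `n` with `|P| ≤ e^B
W^(1/2)` on the line and `|P(i)| ≥ exp(c I_n - B)`; the other half of `W` pays for the factor `1 +
x²`. For rapid growth `I_n` is of order at most `n / R`, and a Taylor section of `exp(-iaz)` with `a
= n / (4R)` works. For normal growth one multiplies quadratics at the scales `2^k`, with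
multiplicities given by second differences of `k ↦ φ(2^k)`: convexity in `log x` makes these
nonnegative, and the decrease of `φ(x) / x²` controls the far factors.

Divergence of the logarithmic integral enters as `I_n → ∞`, which absorbs all additive constants.
Pairing with `(1 + x²)⁻¹`, whose norm is at most `π` in every `L^p`, keeps the constants independent
of `p`. -/

namespace WeightedApprox

/-! ### Half-plane estimates, the Joukowski pullback and Cauchy's formula on the circle -/

open Complex in
lemma re_div_add_nonneg {w : ℂ} {τ : ℝ} (hw : 0 ≤ w.re) (hτ : 0 < τ) :
    0 ≤ (w / (w + τ)).re := by
  rw [Complex.div_re, ← add_div]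
  refine div_nonneg ?_ (normSq_nonneg _)
  simp only [add_re, add_im, ofReal_re, ofReal_im]
  nlinarith [sq_nonneg w.im, mul_nonneg hw hw, mul_nonneg hw hτ.le]

-- Since `|w + τ|² = |w|² + 2τ Re w + τ² ≤ 2(|w|² + τ Re w)` when `τ ≤ |w|`. With the previous
-- bound, `2 Re (w / (w + τ))` is an analytic substitute for the indicator of `|w| ≥ τ` on the right
-- half-plane.
open Complex in
lemma half_le_re_div_add {w : ℂ} {τ : ℝ} (hw : 0 ≤ w.re) (hτ : 0 < τ) (h : τ ≤ ‖w‖) :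
    1 / 2 ≤ (w / (w + τ)).re := by
  have hsq : τ ^ 2 ≤ w.re ^ 2 + w.im ^ 2 := by
    have : τ ^ 2 ≤ ‖w‖ ^ 2 := by gcongr
    rwa [← normSq_eq_norm_sq, normSq_apply, ← sq, ← sq] at this
  rw [Complex.div_re, ← add_div, le_div_iff₀]
  · simp only [add_re, add_im, ofReal_re, ofReal_im, normSq_apply]
    nlinarith
  · rw [normSq_pos]
    intro h0
    have := congrArg re h0
    simp at this
    linarith

/-- The polynomial `ζ ^ n * P (R * (ζ + ζ⁻¹) / 2)` attached to `P` by the Joukowski map. -/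
noncomputable def joukowskiPullback (P : Polynomial ℂ) (n : ℕ) (R : ℝ) (ζ : ℂ) : ℂ :=
  ∑ k ∈ Finset.range (n + 1), P.coeff k * (R / 2 * (ζ ^ 2 + 1)) ^ k * ζ ^ (n - k)

/-- The factor `ζ ^ n` cancels the pole at `0` and has modulus one on the circle, where the argument
of `P` becomes `R cos θ`; its only cost is `|ζ₀| ^ n` at the point of evaluation. -/
lemma joukowskiPullback_eq {P : Polynomial ℂ} {n : ℕ} (hP : P.natDegree ≤ n) (R : ℝ) {ζ : ℂ}
    (hζ : ζ ≠ 0) : joukowskiPullback P n R ζ = ζ ^ n * P.eval (R / 2 * (ζ + ζ⁻¹)) := by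
  rw [joukowskiPullback, Polynomial.eval_eq_sum_range' (Nat.lt_succ_of_le hP), Finset.mul_sum]
  refine Finset.sum_congr rfl fun k hk => ?_
  have hk' : k ≤ n := Nat.lt_succ_iff.1 (Finset.mem_range.1 hk)
  have h1 : (R / 2 * (ζ ^ 2 + 1) : ℂ) = (R / 2 * (ζ + ζ⁻¹)) * ζ := by field_simp
  have h2 : ζ ^ n = ζ ^ k * ζ ^ (n - k) := by rw [← pow_add, Nat.add_sub_cancel' hk']
  rw [h1, mul_pow, h2]
  ring

lemma differentiable_joukowskiPullback (P : Polynomial ℂ) (n : ℕ) (R : ℝ) :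
    Differentiable ℂ (joukowskiPullback P n R) := by
  unfold joukowskiPullback
  fun_prop

/-- The circle covers `[-R, R]` twice, once for each sign of `sin θ`. -/
lemma integral_comp_cos_mul_abs_sin {H : ℝ → ℝ} (hH : Continuous H) (R : ℝ) :
    ∫ θ in (0 : ℝ)..2 * Real.pi, R * |Real.sin θ| * H (R * Real.cos θ) =
      2 * ∫ x in (-R)..R, H x := by
  have hc : Continuous fun θ : ℝ => R * |Real.sin θ| * H (R * Real.cos θ) := by fun_prop
  have hd : ∀ x : ℝ, HasDerivAt (fun θ : ℝ => R * Real.cos θ) (R * -Real.sin x) x :=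
    fun x => (Real.hasDerivAt_cos x).const_mul R
  have hc' : Continuous fun θ : ℝ => R * -Real.sin θ := by fun_prop
  have hpi := Real.pi_pos
  have h1 := intervalIntegral.integral_comp_mul_deriv (a := 0) (b := Real.pi)
    (fun x _ => hd x) hc'.continuousOn hH
  have h2 := intervalIntegral.integral_comp_mul_deriv (a := Real.pi) (b := 2 * Real.pi)
    (fun x _ => hd x) hc'.continuousOn hH
  have e1 : ∫ θ in (0 : ℝ)..Real.pi, R * |Real.sin θ| * H (R * Real.cos θ) =
      ∫ x in (-R)..R, H x := by
    have : ∫ θ in (0 : ℝ)..Real.pi, R * |Real.sin θ| * H (R * Real.cos θ) =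
        ∫ θ in (0 : ℝ)..Real.pi, -((H ∘ fun θ => R * Real.cos θ) θ * (R * -Real.sin θ)) := by
      refine intervalIntegral.integral_congr fun θ hθ => ?_
      rw [uIcc_of_le hpi.le] at hθ
      simp only [Function.comp, abs_of_nonneg (Real.sin_nonneg_of_nonneg_of_le_pi hθ.1 hθ.2)]
      ring
    rw [this, intervalIntegral.integral_neg, h1, intervalIntegral.integral_symm]
    simp
  have e2 : ∫ θ in Real.pi..(2 * Real.pi), R * |Real.sin θ| * H (R * Real.cos θ) =
      ∫ x in (-R)..R, H x := by
    have : ∫ θ in Real.pi..(2 * Real.pi), R * |Real.sin θ| * H (R * Real.cos θ) =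
        ∫ θ in Real.pi..(2 * Real.pi), (H ∘ fun θ => R * Real.cos θ) θ * (R * -Real.sin θ) := by
      refine intervalIntegral.integral_congr fun θ hθ => ?_
      rw [uIcc_of_le (by linarith)] at hθ
      have hs : Real.sin θ ≤ 0 := by
        have := Real.sin_nonneg_of_nonneg_of_le_pi (x := θ - Real.pi) (by linarith [hθ.1])
          (by linarith [hθ.2])
        rw [Real.sin_sub_pi] at this
        linarith
      simp only [Function.comp, abs_of_nonpos hs]
      ring
    rw [this, h2]
    simp
  rw [← intervalIntegral.integral_add_adjacent_intervals (hc.intervalIntegrable _ _)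
    (hc.intervalIntegrable _ _) (b := Real.pi), e1, e2]
  ring

/-- Cauchy's formula in the unit disc with a bound on the unit circle in terms of `R * cos θ`. -/
lemma norm_le_of_circle_bound {f : ℂ → ℂ} (hf : DifferentiableOn ℂ f (Metric.closedBall 0 1))
    {ζ₀ : ℂ} (hζ₀ : ‖ζ₀‖ < 1) {H : ℝ → ℝ} (hH : Continuous H) {R A : ℝ}
    (hb : ∀ θ : ℝ, ‖f (circleMap 0 1 θ)‖ / ‖circleMap 0 1 θ - ζ₀‖ ≤
      A * (R * |Real.sin θ| * H (R * Real.cos θ))) :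
    ‖f ζ₀‖ ≤ A / Real.pi * ∫ x in (-R)..R, H x := by
  have hC := hf.circleIntegral_sub_inv_smul (w := ζ₀) (by simpa using hζ₀)
  have hpi := Real.pi_pos
  have hle : ‖∮ z in C(0, 1), (z - ζ₀)⁻¹ • f z‖ ≤
      ∫ θ in (0 : ℝ)..2 * Real.pi, A * (R * |Real.sin θ| * H (R * Real.cos θ)) := by
    unfold circleIntegral
    refine intervalIntegral.norm_integral_le_of_norm_le (by positivity) ?_
      (Continuous.intervalIntegrable (by fun_prop) _ _)
    refine Eventually.of_forall fun θ _ => ?_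
    refine le_trans (le_of_eq ?_) (hb θ)
    simp [div_eq_inv_mul]
  rw [hC, intervalIntegral.integral_const_mul, integral_comp_cos_mul_abs_sin hH R] at hle
  have hn : ‖(2 * Real.pi * Complex.I : ℂ) • f ζ₀‖ = 2 * Real.pi * ‖f ζ₀‖ := by
    simp [abs_of_pos hpi]
  rw [hn] at hle
  rw [div_mul_eq_mul_div, le_div_iff₀ hpi]
  linarith

end WeightedApprox

/-! ### The value at `i` against a weighted mean on `[-R, R]` -/

namespace WeightedApprox

/-- The last equation says that `ζ₀ = -iρ` is mapped to `i` by `R / 2 * (ζ + ζ⁻¹)`. -/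
lemma exists_joukowski_radius {R : ℝ} (hR : 1 ≤ R) :
    ∃ ρ : ℝ, 1 / 3 ≤ ρ ∧ ρ < 1 ∧ R * (1 - ρ ^ 2) = 2 * ρ := by
  have hR0 : 0 < R := by linarith
  have hs : Real.sqrt (R ^ 2 + 1) ^ 2 = R ^ 2 + 1 := Real.sq_sqrt (by positivity)
  have hs0 := Real.sqrt_nonneg (R ^ 2 + 1)
  set s := Real.sqrt (R ^ 2 + 1)
  refine ⟨(s - 1) / R, ?_, ?_, ?_⟩
  · rw [le_div_iff₀ hR0]
    nlinarith
  · rw [div_lt_one hR0]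
    nlinarith
  · field_simp
    linear_combination -hs

section CircleEstimates

open Complex

lemma circleMap_add_inv (θ : ℝ) :
    circleMap 0 1 θ + (circleMap 0 1 θ)⁻¹ = 2 * (Real.cos θ : ℂ) := by
  simp only [circleMap, ofReal_one, one_mul, zero_add, ← Complex.exp_neg, ofReal_cos, Complex.cos]
  ring_nf

lemma norm_one_sub_circleMap_sq (θ : ℝ) : ‖1 - circleMap 0 1 θ ^ 2‖ = 2 * |Real.sin θ| := by
  have h0 : circleMap 0 1 θ ≠ 0 := circleMap_ne_center one_ne_zero
  have h1 : ‖circleMap 0 1 θ‖ = 1 := by simp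
  have h : 1 - circleMap 0 1 θ ^ 2 = circleMap 0 1 θ * (-(2 * I) * (Real.sin θ : ℂ)) := by
    have hinv : circleMap 0 1 θ * ((circleMap 0 1 θ)⁻¹ - circleMap 0 1 θ) =
      1 - circleMap 0 1 θ ^ 2 := by field_simp
    rw [← hinv]
    congr 1
    simp only [circleMap, ofReal_one, one_mul, zero_add, ← Complex.exp_neg, ofReal_sin,
      Complex.sin, neg_mul]
    linear_combination (Complex.exp (-(θ * I)) - Complex.exp (θ * I)) * I_sq
  rw [h, norm_mul, norm_mul, h1]
  simp [-Complex.ofReal_sin]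

lemma re_one_sub_I_mul_nonneg {ζ : ℂ} (h : ‖ζ‖ ≤ 1) : 0 ≤ (1 - I * ζ).re := by
  have := abs_le.1 ((abs_im_le_norm ζ).trans h)
  simp
  linarith

lemma abs_cos_le_norm (θ : ℝ) : |Real.cos θ| ≤ ‖1 - I * circleMap 0 1 θ‖ := by
  refine le_trans (le_of_eq ?_) (abs_im_le_norm _)
  simp [circleMap, exp_ofReal_mul_I_re]

lemma norm_one_sub_mul_circleMap (ρ θ : ℝ) :
    ‖1 - ρ * (I * circleMap 0 1 θ)‖ = ‖circleMap 0 1 θ - -(I * ρ)‖ := by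
  have h0 : circleMap 0 1 θ ≠ 0 := circleMap_ne_center one_ne_zero
  have h1 : ‖circleMap 0 1 θ‖ = 1 := by simp
  have hc : (starRingEnd ℂ) (circleMap 0 1 θ) = (circleMap 0 1 θ)⁻¹ := by
    rw [Complex.inv_def, normSq_eq_norm_sq, h1]
    simp
  have : 1 - ρ * (I * circleMap 0 1 θ) =
      circleMap 0 1 θ * (starRingEnd ℂ) (circleMap 0 1 θ - -(I * ρ)) := by
    rw [map_sub, hc]
    simp only [map_neg, map_mul, conj_I, conj_ofReal]
    field_simp
  rw [this, norm_mul, h1, one_mul, norm_conj]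

/-- The equation `R / 2 * (ζ + ζ⁻¹) = i` has the roots `-iρ` and `i / ρ`, so `x - i` factors. The
factor of the far root is at most `2 / ρ` on the circle. -/
lemma norm_mul_cos_sub_I_le {R ρ : ℝ} (hR : 0 < R) (hρ : 0 < ρ) (hρ1 : ρ < 1)
    (h : R * (1 - ρ ^ 2) = 2 * ρ) (θ : ℝ) :
    ‖((R * Real.cos θ : ℝ) : ℂ) - I‖ ≤ R / ρ * ‖circleMap 0 1 θ - -(I * ρ)‖ := by
  have h0 : circleMap 0 1 θ ≠ 0 := circleMap_ne_center one_ne_zero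
  have h1 : ‖circleMap 0 1 θ‖ = 1 := by simp
  have hρ0 : (ρ : ℂ) ≠ 0 := by exact_mod_cast hρ.ne'
  have hcos : (Real.cos θ : ℂ) = (circleMap 0 1 θ + (circleMap 0 1 θ)⁻¹) / 2 := by
    rw [circleMap_add_inv]; ring
  have hc : (R : ℂ) * (1 - (ρ : ℂ) ^ 2) = 2 * ρ := by exact_mod_cast h
  have key : ((R * Real.cos θ : ℝ) : ℂ) - I =
      R / 2 * (circleMap 0 1 θ - -(I * ρ)) * (1 - I * (circleMap 0 1 θ)⁻¹ * (ρ : ℂ)⁻¹) := by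
    rw [ofReal_mul, hcos]
    field_simp
    linear_combination (circleMap 0 1 θ * I) * hc + (ρ * R) * I_sq
  rw [key, norm_mul, norm_mul]
  have hlast : ‖1 - I * (circleMap 0 1 θ)⁻¹ * (ρ : ℂ)⁻¹‖ ≤ 2 / ρ := by
    refine (norm_sub_le _ _).trans ?_
    simp only [norm_one, norm_mul, norm_I, norm_inv, h1, Complex.norm_real, Real.norm_eq_abs,
      abs_of_pos hρ]
    rw [le_div_iff₀ hρ]
    field_simp
    linarith
  have hn : ‖(R / 2 : ℂ)‖ = R / 2 := by simp [abs_of_pos hR]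
  rw [hn]
  calc R / 2 * ‖circleMap 0 1 θ - -(I * ρ)‖ * ‖1 - I * (circleMap 0 1 θ)⁻¹ * (ρ : ℂ)⁻¹‖
      ≤ R / 2 * ‖circleMap 0 1 θ - -(I * ρ)‖ * (2 / ρ) := by gcongr
    _ = _ := by ring

end CircleEstimates

section

open Complex

/-- An analytic function in the disc whose real part on the unit circle dominates the step
function `∑ c k * 1_{|R cos θ| ≥ t k}`. -/
noncomputable def stepMajorant (R : ℝ) (K : ℕ) (c t : ℕ → ℝ) (ζ : ℂ) : ℂ :=
  ∑ k ∈ Finset.range K, ((2 * c k : ℝ) : ℂ) *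
    ((1 - I * ζ) / (1 - I * ζ + (t k / R : ℝ)))

lemma differentiableOn_stepMajorant {R : ℝ} (hR : 0 < R) (K : ℕ) (c : ℕ → ℝ) {t : ℕ → ℝ}
    (ht : ∀ k, 0 < t k) :
    DifferentiableOn ℂ (stepMajorant R K c t) (Metric.closedBall 0 1) := by
  unfold stepMajorant
  refine DifferentiableOn.fun_sum fun k _ => DifferentiableOn.const_mul ?_ _
  refine DifferentiableOn.div (by fun_prop) (by fun_prop) fun ζ hζ h0 => ?_
  have h1 := re_one_sub_I_mul_nonneg (ζ := ζ) (by simpa using hζ)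
  have h2 := congrArg re h0
  rw [add_re, ofReal_re, zero_re] at h2
  have := div_pos (ht k) hR
  linarith

lemma le_re_stepMajorant {R : ℝ} (hR : 0 < R) (K : ℕ) {c t : ℕ → ℝ} (hc : ∀ k, 0 ≤ c k)
    (ht : ∀ k, 0 < t k) (θ : ℝ) :
    ∑ k ∈ Finset.range K, (if t k ≤ |R * Real.cos θ| then c k else 0) ≤
      (stepMajorant R K c t (circleMap 0 1 θ)).re := by
  have hw := re_one_sub_I_mul_nonneg (ζ := circleMap 0 1 θ) (by simp)
  rw [stepMajorant, re_sum]
  refine Finset.sum_le_sum fun k _ => ?_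
  rw [re_ofReal_mul]
  have hτ := div_pos (ht k) hR
  split_ifs with h
  · have hn : t k / R ≤ ‖1 - I * circleMap 0 1 θ‖ := by
      refine le_trans ?_ (abs_cos_le_norm θ)
      rw [abs_mul, abs_of_pos hR] at h
      rw [div_le_iff₀ hR]
      linarith
    have := half_le_re_div_add hw hτ hn
    nlinarith [hc k]
  · exact mul_nonneg (by linarith [hc k]) (re_div_add_nonneg hw hτ)

/-- At `-iρ` the variable `1 - iζ` equals `1 - ρ ≤ 2 / R`, so a step at height `t` contributes only
`O(c / t)`, independently of `R`. -/
lemma re_stepMajorant_le {R ρ : ℝ} (hR : 0 < R) (hρ1 : ρ < 1) (h : (1 - ρ) * R ≤ 2)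
    (K : ℕ) {c t : ℕ → ℝ} (hc : ∀ k, 0 ≤ c k) (ht : ∀ k, 0 < t k) :
    (stepMajorant R K c t (-(I * ρ))).re ≤ 4 * ∑ k ∈ Finset.range K, c k / t k := by
  rw [stepMajorant, re_sum, Finset.mul_sum]
  refine Finset.sum_le_sum fun k _ => ?_
  have e : (1 - I * -(I * ρ) : ℂ) = ((1 - ρ : ℝ) : ℂ) := by
    push_cast
    linear_combination (ρ : ℂ) * I_sq
  rw [e, ← ofReal_add, ← ofReal_div, ← ofReal_mul, ofReal_re]
  have hτ := div_pos (ht k) hR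
  have h1 : (1 - ρ) / (1 - ρ + t k / R) ≤ 2 / t k := by
    rw [div_le_div_iff₀ (by linarith) (ht k)]
    have : t k / R * R = t k := div_mul_cancel₀ _ hR.ne'
    nlinarith [ht k]
  calc 2 * c k * ((1 - ρ) / (1 - ρ + t k / R)) ≤ 2 * c k * (2 / t k) := by
        gcongr
        linarith [hc k]
    _ = 4 * (c k / t k) := by ring

/-- A weighted mean on `[-R, R]` controls the value of a polynomial at `i`. -/
theorem norm_eval_I_le_integral {P : Polynomial ℂ} {n : ℕ} (hP : P.natDegree ≤ n) {R : ℝ}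
    (hR : 1 ≤ R) (K : ℕ) {c t : ℕ → ℝ} (hc : ∀ k, 0 ≤ c k) (ht : ∀ k, 0 < t k) {V : ℝ → ℝ}
    (hV : Continuous V) {B : ℝ} (hVB : ∀ x, |x| ≤ R →
      V x ≤ B + ∑ k ∈ Finset.range K, (if t k ≤ |x| then c k else 0)) :
    Real.exp (-(2 * n / R) - 4 * ∑ k ∈ Finset.range K, c k / t k) * ‖P.eval I‖ ≤
      32 * Real.exp B * ∫ x in (-R)..R,
        ‖P.eval (x : ℂ)‖ / (‖(x : ℂ) - I‖ * Real.exp (V x) * (1 + x ^ 2)) := by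
  have hR0 : 0 < R := by linarith
  obtain ⟨ρ, hρ3, hρ1, hρ⟩ := exists_joukowski_radius hR
  have hρ0 : 0 < ρ := by linarith
  have hρR : (1 - ρ) * R ≤ 2 * ρ := by nlinarith [mul_pos hR0 hρ0, mul_pos (sub_pos.2 hρ1) hρ0]
  have hxI : ∀ x : ℝ, ‖(x : ℂ) - I‖ ^ 2 = 1 + x ^ 2 := fun x => by
    rw [← normSq_eq_norm_sq, normSq_apply]; simp; ring
  have hxI0 : ∀ x : ℝ, 0 < ‖(x : ℂ) - I‖ := fun x => by
    have := hxI x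
    rcases (norm_nonneg ((x : ℂ) - I)).eq_or_lt with h | h
    · rw [← h] at this; nlinarith
    · exact h
  set H : ℝ → ℝ := fun x =>
    ‖P.eval (x : ℂ)‖ / (‖(x : ℂ) - I‖ * Real.exp (V x) * (1 + x ^ 2)) with hHdef
  have hH : Continuous H := by
    refine Continuous.div (by fun_prop) (by fun_prop) fun x => ?_
    have := hxI0 x
    positivity
  set ζ₀ : ℂ := -(I * ρ) with hζ₀
  have hζn : ‖ζ₀‖ = ρ := by simp [ζ₀, abs_of_pos hρ0]
  -- On the circle `|1 - ζ²| = 2 |sin θ|` supplies the Jacobian of `x = R cos θ`. The squared factor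
  -- has modulus `((1 - ρ) / |ζ - ζ₀|)²`, which is `O(1 / (1 + x²))`. At `ζ₀` the two together stay
  -- above `1 / 4`.
  set f : ℂ → ℂ := fun ζ => joukowskiPullback P n R ζ * cexp (-stepMajorant R K c t ζ) *
    (1 - ζ ^ 2) * ((1 - ρ) / (1 - ρ * (I * ζ))) ^ 2 with hf
  have hden : ∀ ζ : ℂ, ‖ζ‖ ≤ 1 → (1 - ρ * (I * ζ) : ℂ) ≠ 0 := by
    intro ζ hζ h0
    have h1 : ‖(ρ * (I * ζ) : ℂ)‖ = 1 := by rw [← sub_eq_zero.1 h0]; simp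
    rw [norm_mul, norm_mul, norm_I, Complex.norm_real, Real.norm_eq_abs, abs_of_pos hρ0] at h1
    nlinarith [norm_nonneg ζ]
  have hfd : DifferentiableOn ℂ f (Metric.closedBall 0 1) := by
    refine DifferentiableOn.mul (DifferentiableOn.mul (DifferentiableOn.mul
      (differentiable_joukowskiPullback P n R).differentiableOn ?_) (by fun_prop))
      (DifferentiableOn.pow (DifferentiableOn.div (by fun_prop) (by fun_prop) ?_) 2)
    · exact (differentiableOn_stepMajorant hR0 K c ht).neg.cexp
    · exact fun ζ hζ => hden ζ (by simpa using hζ)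
  have hup := norm_le_of_circle_bound (A := 24 * Real.exp B) (R := R) hfd
    (by rw [hζn]; exact hρ1) hH (by
      intro θ
      set ζ := circleMap 0 1 θ with hζ
      have h0 : ζ ≠ 0 := circleMap_ne_center one_ne_zero
      have h1 : ‖ζ‖ = 1 := by simp [ζ]
      have hJ : ‖joukowskiPullback P n R ζ‖ = ‖P.eval ((R * Real.cos θ : ℝ) : ℂ)‖ := by
        rw [joukowskiPullback_eq hP R h0, norm_mul, norm_pow, h1, one_pow, one_mul, hζ,
          circleMap_add_inv]
        congr 2
        push_cast
        ring
      set x := R * Real.cos θ with hx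
      have hxR : |x| ≤ R := by
        rw [hx, abs_mul, abs_of_pos hR0]
        exact mul_le_of_le_one_right hR0.le (Real.abs_cos_le_one θ)
      have hE : ‖cexp (-stepMajorant R K c t ζ)‖ ≤ Real.exp B / Real.exp (V x) := by
        rw [Complex.norm_exp, neg_re, ← Real.exp_sub, Real.exp_le_exp]
        linarith [hVB x hxR, le_re_stepMajorant hR0 K hc ht θ]
      have hN := norm_mul_cos_sub_I_le hR0 hρ0 hρ1 hρ θ
      rw [← hζ, ← hx, ← hζ₀] at hN
      have hg : ‖((1 - ρ) / (1 - ρ * (I * ζ)) : ℂ) ^ 2‖ = ((1 - ρ) / ‖ζ - ζ₀‖) ^ 2 := by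
        rw [norm_pow, norm_div, hζ, norm_one_sub_mul_circleMap, ← hζ]
        congr 2
        rw [← ofReal_one, ← ofReal_sub, Complex.norm_real, Real.norm_eq_abs,
          abs_of_pos (by linarith)]
      have hD : 0 < ‖ζ - ζ₀‖ := by
        by_contra hcon
        have : ‖ζ - ζ₀‖ = 0 := le_antisymm (not_lt.1 hcon) (norm_nonneg _)
        rw [this, mul_zero] at hN
        linarith [hxI0 x]
      have hNx := hxI0 x
      have hkey : ((1 - ρ) / ‖ζ - ζ₀‖) ^ 2 / ‖ζ - ζ₀‖ ≤ 12 * R / ‖(x : ℂ) - I‖ ^ 3 := by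
        have hinv : 1 / ‖ζ - ζ₀‖ ≤ R / ρ / ‖(x : ℂ) - I‖ := by
          rw [div_le_div_iff₀ hD hNx]; linarith
        have h3 : (1 - ρ) * (R / ρ) ≤ 2 := by
          rw [← mul_div_assoc, div_le_iff₀ hρ0]; exact hρR
        have h4 : R / ρ ≤ 3 * R := by rw [div_le_iff₀ hρ0]; nlinarith
        have h5 : 0 ≤ (1 - ρ) * (R / ρ) := mul_nonneg (by linarith) (by positivity)
        calc ((1 - ρ) / ‖ζ - ζ₀‖) ^ 2 / ‖ζ - ζ₀‖ = (1 - ρ) ^ 2 * (1 / ‖ζ - ζ₀‖) ^ 3 := by ring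
          _ ≤ (1 - ρ) ^ 2 * (R / ρ / ‖(x : ℂ) - I‖) ^ 3 := by gcongr
          _ = ((1 - ρ) * (R / ρ)) ^ 2 * (R / ρ) / ‖(x : ℂ) - I‖ ^ 3 := by ring
          _ ≤ 2 ^ 2 * (3 * R) / ‖(x : ℂ) - I‖ ^ 3 := by gcongr
          _ = _ := by ring
      calc ‖f ζ‖ / ‖ζ - ζ₀‖
          = ‖P.eval (x : ℂ)‖ * ‖cexp (-stepMajorant R K c t ζ)‖ * (2 * |Real.sin θ|) *
            (((1 - ρ) / ‖ζ - ζ₀‖) ^ 2 / ‖ζ - ζ₀‖) := by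
            simp only [hf]
            rw [norm_mul, norm_mul, norm_mul, hJ, hg, hζ, norm_one_sub_circleMap_sq]
            ring
        _ ≤ ‖P.eval (x : ℂ)‖ * (Real.exp B / Real.exp (V x)) * (2 * |Real.sin θ|) *
            (12 * R / ‖(x : ℂ) - I‖ ^ 3) := by gcongr
        _ = 24 * Real.exp B * (R * |Real.sin θ| * H x) := by
            simp only [hHdef]
            rw [← hxI x]
            have := Real.exp_pos (V x)
            field_simp
            ring)
  have hζ00 : ζ₀ ≠ 0 := by
    rw [← norm_pos_iff, hζn]; exact hρ0
  have hIimg : (R / 2 * (ζ₀ + ζ₀⁻¹) : ℂ) = I := by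
    have hρc : (ρ : ℂ) ≠ 0 := by exact_mod_cast hρ0.ne'
    have hcc : (R : ℂ) * (1 - (ρ : ℂ) ^ 2) = 2 * ρ := by exact_mod_cast hρ
    have : ζ₀⁻¹ = I / ρ := by
      rw [hζ₀, inv_neg, mul_inv, inv_I]; ring
    rw [this, hζ₀]
    field_simp
    linear_combination hcc
  have hval : ‖f ζ₀‖ = ρ ^ n * ‖P.eval I‖ * Real.exp (-(stepMajorant R K c t ζ₀).re) *
      ((1 + ρ ^ 2) * (1 / (1 + ρ)) ^ 2) := by
    have e1 : (1 - ζ₀ ^ 2 : ℂ) = ((1 + ρ ^ 2 : ℝ) : ℂ) := by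
      rw [hζ₀]; push_cast; linear_combination (-(ρ : ℂ) ^ 2) * I_sq
    have e2 : ((1 - ρ) / (1 - ρ * (I * ζ₀)) : ℂ) = ((1 / (1 + ρ) : ℝ) : ℂ) := by
      have : (1 - ρ * (I * ζ₀) : ℂ) = (1 - ρ) * (1 + ρ) := by
        rw [hζ₀]; linear_combination (ρ : ℂ) ^ 2 * I_sq
      have h1 : (1 - ρ : ℂ) ≠ 0 := by
        rw [← ofReal_one, ← ofReal_sub]; exact_mod_cast (by linarith : (1 - ρ) ≠ 0)
      have h2 : (1 + ρ : ℂ) ≠ 0 := by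
        rw [← ofReal_one, ← ofReal_add]; exact_mod_cast (by linarith : (1 + ρ) ≠ 0)
      rw [this]
      push_cast
      field_simp
    simp only [hf]
    rw [joukowskiPullback_eq hP R hζ00, hIimg, e1, e2, norm_mul, norm_mul, norm_mul, norm_mul,
      norm_pow, norm_pow, hζn, Complex.norm_exp, Complex.norm_real, Complex.norm_real,
      Real.norm_of_nonneg (by positivity), Real.norm_of_nonneg (by positivity), neg_re]
    ring
  have hfac : (1 : ℝ) / 4 ≤ (1 + ρ ^ 2) * (1 / (1 + ρ)) ^ 2 := by
    rw [div_pow, one_pow, mul_one_div, div_le_div_iff₀ (by norm_num) (by positivity)]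
    nlinarith
  -- `log ρ⁻¹ ≤ ρ⁻¹ - 1 ≤ 2 / R`.
  have hρn : Real.exp (-(2 * n / R)) ≤ ρ ^ n := by
    have h1 : Real.exp (-(2 / R)) ≤ ρ := by
      have hl : Real.log ρ⁻¹ ≤ ρ⁻¹ - 1 := Real.log_le_sub_one_of_pos (by positivity)
      have h2 : ρ⁻¹ - 1 ≤ 2 / R := by
        rw [le_div_iff₀ hR0]
        field_simp
        linarith
      rw [Real.log_inv] at hl
      rw [← Real.le_log_iff_exp_le hρ0]
      linarith
    calc Real.exp (-(2 * n / R)) = Real.exp (-(2 / R)) ^ n := by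
          rw [← Real.exp_nat_mul]; congr 1; ring
      _ ≤ ρ ^ n := by gcongr
  have hS := re_stepMajorant_le hR0 hρ1 (h := by linarith) K hc ht
  have hI : 0 ≤ ∫ x in (-R)..R, H x :=
    intervalIntegral.integral_nonneg (by linarith) fun x _ => by simp only [hHdef]; positivity
  have hlow : Real.exp (-(2 * n / R) - 4 * ∑ k ∈ Finset.range K, c k / t k) * ‖P.eval I‖ * (1 / 4)
      ≤ ‖f ζ₀‖ := by
    rw [hval]
    calc Real.exp (-(2 * n / R) - 4 * ∑ k ∈ Finset.range K, c k / t k) * ‖P.eval I‖ * (1 / 4)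
        = Real.exp (-(2 * n / R)) * ‖P.eval I‖ *
          Real.exp (-(4 * ∑ k ∈ Finset.range K, c k / t k)) * (1 / 4) := by
          rw [sub_eq_add_neg, Real.exp_add]; ring
      _ ≤ _ := by gcongr
  have hpi : 24 * Real.exp B / Real.pi ≤ 8 * Real.exp B := by
    rw [div_le_iff₀ Real.pi_pos]
    nlinarith [Real.pi_gt_three, Real.exp_pos B]
  have := hlow.trans (hup.trans (mul_le_mul_of_nonneg_right hpi hI))
  linarith

end

end WeightedApprox

/-! ### Weighted norms, and the passage from polynomials to `E_n` -/

namespace WeightedApprox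

section Norms

/-- The function is at most `1`, so its `p`-th power is below itself, and `π^(1/p) ≤ π`. Uniformity
in `p` of all later constants rests on this. -/
lemma eLpNorm_inv_one_add_sq_le {p : ℝ≥0∞} (hp : 1 ≤ p) :
    eLpNorm (fun x : ℝ => (1 + x ^ 2)⁻¹) p volume ≤ ENNReal.ofReal Real.pi := by
  have hpi : 1 ≤ ENNReal.ofReal Real.pi := by
    rw [ENNReal.one_le_ofReal]; linarith [Real.pi_gt_three]
  have hle : ∀ x : ℝ, ‖(1 + x ^ 2)⁻¹‖ₑ ≤ 1 := fun x => by
    rw [Real.enorm_of_nonneg (by positivity), ENNReal.ofReal_le_one]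
    exact inv_le_one_of_one_le₀ (by nlinarith)
  rcases eq_or_ne p ∞ with rfl | hp'
  · rw [eLpNorm_exponent_top]
    exact (eLpNormEssSup_le_of_ae_enorm_bound (Eventually.of_forall hle)).trans hpi
  have hp1 : 1 ≤ p.toReal := by
    rw [← ENNReal.toReal_one]; exact ENNReal.toReal_mono hp' hp
  rw [eLpNorm_eq_lintegral_rpow_enorm_toReal (by positivity) hp']
  calc (∫⁻ x : ℝ, ‖(1 + x ^ 2)⁻¹‖ₑ ^ p.toReal) ^ (1 / p.toReal)
      ≤ (∫⁻ x : ℝ, ENNReal.ofReal ((1 + x ^ 2)⁻¹)) ^ (1 / p.toReal) := by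
        gcongr with x
        refine (ENNReal.rpow_le_rpow_of_exponent_ge (hle x) hp1).trans ?_
        rw [ENNReal.rpow_one, Real.enorm_of_nonneg (by positivity)]
    _ = ENNReal.ofReal Real.pi ^ (1 / p.toReal) := by
        rw [← ofReal_integral_eq_lintegral_ofReal integrable_inv_one_add_sq
          (Eventually.of_forall fun x => by positivity), integral_univ_inv_one_add_sq]
    _ ≤ ENNReal.ofReal Real.pi ^ (1 : ℝ) := by
        refine ENNReal.rpow_le_rpow_of_exponent_le hpi ?_
        rw [div_le_one (by linarith)]
        exact hp1
    _ = _ := ENNReal.rpow_one _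

lemma eLpNorm_div_le_weightedNorm (p : ℝ≥0∞) (W : ℝ → ℝ) (f : ℝ → ℂ) :
    eLpNorm (fun x => f x / (W x : ℂ)) p volume ≤ weightedNorm p W f := by
  rw [weightedNorm]
  split_ifs with h
  · rw [h, eLpNorm_exponent_top]
    exact eLpNormEssSup_le_of_ae_enorm_bound
      (Eventually.of_forall fun x => le_iSup (fun x => ‖f x / (W x : ℂ)‖ₑ) x)
  · exact le_rfl

lemma weightedNorm_le {p : ℝ≥0∞} (hp : 1 ≤ p) {W : ℝ → ℝ} {f : ℝ → ℂ} {b : ℝ} (hb : 0 ≤ b)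
    (h : ∀ x, ‖f x / (W x : ℂ)‖ ≤ b * (1 + x ^ 2)⁻¹) :
    weightedNorm p W f ≤ ENNReal.ofReal (b * Real.pi) := by
  rw [weightedNorm]
  split_ifs with hp'
  · refine iSup_le fun x => ?_
    rw [← ofReal_norm]
    refine ENNReal.ofReal_le_ofReal ((h x).trans ?_)
    gcongr
    refine (inv_le_one_of_one_le₀ (by nlinarith)).trans ?_
    linarith [Real.pi_gt_three]
  · rw [ENNReal.ofReal_mul hb]
    refine (eLpNorm_le_mul_eLpNorm_of_ae_le_mul (g := fun x : ℝ => (1 + x ^ 2)⁻¹) (c := b)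
      (Eventually.of_forall fun x => ?_) p).trans ?_
    · rw [Real.norm_of_nonneg (by positivity : 0 ≤ (1 + x ^ 2)⁻¹)]
      exact h x
    · gcongr
      exact eLpNorm_inv_one_add_sq_le hp

/-- Hölder against `(1 + x²)⁻¹`, whose conjugate norm is at most `π`. -/
lemma ofReal_integral_le_weightedNorm {p : ℝ≥0∞} (hp : 1 ≤ p) {W : ℝ → ℝ} (hW : Continuous W)
    (hW0 : ∀ x, W x ≠ 0) {f : ℝ → ℂ} (hf : Continuous f) (R : ℝ) (hR : 0 ≤ R) :
    ENNReal.ofReal (∫ x in (-R)..R, ‖f x / (W x : ℂ)‖ * (1 + x ^ 2)⁻¹) ≤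
      ENNReal.ofReal Real.pi * weightedNorm p W f := by
  have hF : Continuous fun x => f x / (W x : ℂ) :=
    hf.div (by fun_prop) fun x => by exact_mod_cast hW0 x
  have hg : Continuous fun x : ℝ => (1 + x ^ 2)⁻¹ :=
    Continuous.inv₀ (by fun_prop) fun x => by positivity
  have hH := (ENNReal.HolderConjugate.conjExponent hp).symm
  have hq : 1 ≤ ENNReal.conjExponent p := hH.one_le
  have key := eLpNorm_smul_le_mul_eLpNorm (μ := volume) (p := ENNReal.conjExponent p) (q := p)
    (r := 1) hF.aestronglyMeasurable hg.aestronglyMeasurable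
  rw [intervalIntegral.integral_of_le (by linarith), ofReal_integral_eq_lintegral_ofReal]
  · calc ∫⁻ x in Ioc (-R) R, ENNReal.ofReal (‖f x / (W x : ℂ)‖ * (1 + x ^ 2)⁻¹)
        ≤ ∫⁻ x : ℝ, ENNReal.ofReal (‖f x / (W x : ℂ)‖ * (1 + x ^ 2)⁻¹) :=
          setLIntegral_le_lintegral _ _
      _ = eLpNorm ((fun x : ℝ => (1 + x ^ 2)⁻¹) • fun x => f x / (W x : ℂ)) 1 volume := by
          rw [eLpNorm_one_eq_lintegral_enorm]
          refine lintegral_congr fun x => ?_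
          rw [← ofReal_norm, Pi.smul_apply', norm_smul,
            Real.norm_of_nonneg (by positivity : 0 ≤ (1 + x ^ 2)⁻¹), mul_comm]
      _ ≤ _ := key.trans (mul_le_mul' (eLpNorm_inv_one_add_sq_le hq)
          (eLpNorm_div_le_weightedNorm p W f))
  · exact ((hF.norm.mul hg).intervalIntegrable (-R) R).1
  · exact Eventually.of_forall fun x => by positivity

end Norms

section CauchyError

open Complex

lemma one_le_norm_sub_I (x : ℝ) : 1 ≤ ‖(x : ℂ) - I‖ := by
  have := abs_im_le_norm ((x : ℂ) - I)
  simpa using this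

lemma ofReal_sub_I_ne_zero (x : ℝ) : (x : ℂ) - I ≠ 0 :=
  norm_pos_iff.1 (zero_lt_one.trans_le (one_le_norm_sub_I x))

/-- `1 - P / P(i)` vanishes at `i`; its quotient by `z - i` is the approximant. -/
lemma cauchyError_le_of_polynomial {p : ℝ≥0∞} (hp : 1 ≤ p) {W : ℝ → ℝ} (hW : ∀ x, 0 < W x)
    {P : Polynomial ℂ} {n : ℕ} (hP : P.natDegree ≤ n) (hPI : P.eval I ≠ 0) {b : ℝ}
    (hb : 0 ≤ b) (h : ∀ x : ℝ, ‖P.eval (x : ℂ)‖ * (1 + x ^ 2) ≤ b * W x) :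
    cauchyError p W n ≤ ENNReal.ofReal (b / ‖P.eval I‖ * Real.pi) := by
  set T : Polynomial ℂ := 1 - Polynomial.C (P.eval I)⁻¹ * P with hT
  have hroot : T.IsRoot I := by simp [hT, hPI]
  obtain ⟨Q, hQ⟩ := Polynomial.dvd_iff_isRoot.2 hroot
  have hTdeg : T.natDegree ≤ n := by
    refine (Polynomial.natDegree_sub_le _ _).trans (max_le (by simp) ?_)
    exact (Polynomial.natDegree_C_mul_le _ _).trans hP
  have hQdeg : Q ∈ Polynomial.degreeLT ℂ n := by
    rw [Polynomial.mem_degreeLT]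
    rcases eq_or_ne Q 0 with rfl | hQ0
    · simp
    rw [Polynomial.degree_eq_natDegree hQ0]
    rw [hQ, Polynomial.natDegree_mul (Polynomial.X_sub_C_ne_zero _) hQ0,
      Polynomial.natDegree_X_sub_C] at hTdeg
    exact_mod_cast (by omega : Q.natDegree < n)
  refine (iInf₂_le Q hQdeg).trans (weightedNorm_le hp (by positivity) fun x => ?_)
  have hx := ofReal_sub_I_ne_zero x
  have hval : 1 / ((x : ℂ) - I) - Q.eval (x : ℂ) = P.eval (x : ℂ) / (P.eval I * (x - I)) := by
    have h1 := congrArg (Polynomial.eval (x : ℂ)) hQ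
    simp only [hT, Polynomial.eval_sub, Polynomial.eval_one, Polynomial.eval_mul,
      Polynomial.eval_C, Polynomial.eval_X] at h1
    field_simp at h1 ⊢
    linear_combination h1
  have hPI0 := norm_pos_iff.2 hPI
  have hW0 := hW x
  rw [hval, norm_div, norm_div, norm_mul, Complex.norm_real, Real.norm_of_nonneg hW0.le]
  have h1 := one_le_norm_sub_I x
  have h2 := h x
  calc ‖P.eval (x : ℂ)‖ / (‖P.eval I‖ * ‖(x : ℂ) - I‖) / W x
      ≤ ‖P.eval (x : ℂ)‖ / (‖P.eval I‖ * 1) / W x := by gcongr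
    _ ≤ b / ‖P.eval I‖ * (1 + x ^ 2)⁻¹ := by
      rw [mul_one, div_div, ← div_eq_mul_inv, div_div, div_le_div_iff₀ (by positivity)
        (by positivity)]
      calc _ = ‖P.eval I‖ * (‖P.eval (x : ℂ)‖ * (1 + x ^ 2)) := by ring
        _ ≤ ‖P.eval I‖ * (b * W x) := by gcongr
        _ = _ := by ring

lemma le_cauchyError_of_polynomial {p : ℝ≥0∞} (hp : 1 ≤ p) {W : ℝ → ℝ} (hW : Continuous W)
    (hW0 : ∀ x, 0 < W x) {n : ℕ} {R a : ℝ} (hR : 0 ≤ R)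
    (h : ∀ P : Polynomial ℂ, P.natDegree ≤ n → P.eval I = 1 → a ≤ ∫ x in (-R)..R,
      ‖P.eval (x : ℂ)‖ / (‖(x : ℂ) - I‖ * W x * (1 + x ^ 2))) :
    ENNReal.ofReal (a / Real.pi) ≤ cauchyError p W n := by
  refine le_iInf₂ fun Q hQ => ?_
  set P : Polynomial ℂ := 1 - (Polynomial.X - Polynomial.C I) * Q with hP
  have hdeg : P.natDegree ≤ n := by
    refine (Polynomial.natDegree_sub_le _ _).trans (max_le (by simp) ?_)
    rcases eq_or_ne Q 0 with rfl | hQ0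
    · simp
    rw [Polynomial.mem_degreeLT, Polynomial.degree_eq_natDegree hQ0] at hQ
    refine Polynomial.natDegree_mul_le.trans ?_
    rw [Polynomial.natDegree_X_sub_C]
    have : Q.natDegree < n := by exact_mod_cast hQ
    omega
  have hint := h P hdeg (by simp [hP])
  have hcont : Continuous fun x : ℝ => 1 / ((x : ℂ) - I) - Q.eval (x : ℂ) := by
    refine Continuous.sub (Continuous.div (by fun_prop) (by fun_prop) ofReal_sub_I_ne_zero) ?_
    fun_prop
  have key := ofReal_integral_le_weightedNorm hp hW (fun x => (hW0 x).ne') hcont R hR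
  have heq : ∀ x : ℝ, ‖(1 / ((x : ℂ) - I) - Q.eval (x : ℂ)) / (W x : ℂ)‖ * (1 + x ^ 2)⁻¹ =
      ‖P.eval (x : ℂ)‖ / (‖(x : ℂ) - I‖ * W x * (1 + x ^ 2)) := by
    intro x
    have hx := ofReal_sub_I_ne_zero x
    have : 1 / ((x : ℂ) - I) - Q.eval (x : ℂ) = P.eval (x : ℂ) / (x - I) := by
      simp only [hP, Polynomial.eval_sub, Polynomial.eval_one, Polynomial.eval_mul,
        Polynomial.eval_C, Polynomial.eval_X]
      field_simp
    rw [this, norm_div, norm_div, Complex.norm_real, Real.norm_of_nonneg (hW0 x).le,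
      ← div_eq_mul_inv, div_div, div_div, mul_assoc]
  simp only [heq] at key
  have h2 := (ENNReal.ofReal_le_ofReal hint).trans key
  rw [ENNReal.ofReal_div_of_pos Real.pi_pos]
  refine ENNReal.div_le_of_le_mul ?_
  rwa [mul_comm]

lemma cauchyError_antitone (p : ℝ≥0∞) (W : ℝ → ℝ) : Antitone (cauchyError p W) := by
  intro m n hmn
  exact biInf_mono fun Q hQ => Polynomial.degreeLT_mono hmn hQ

end CauchyError

/-! ### Elementary consequences of the hypotheses on the weight -/

namespace IsWeightExponent

variable {φ : ℝ → ℝ}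

lemma continuous_comp_abs (hφ : IsWeightExponent φ) : Continuous fun x : ℝ => φ |x| :=
  hφ.continuousOn.comp_continuous continuous_abs abs_nonneg

lemma continuous_weight (hφ : IsWeightExponent φ) : Continuous (weight φ) :=
  Real.continuous_exp.comp hφ.continuous_comp_abs

lemma mono (hφ : IsWeightExponent φ) {x y : ℝ} (hx : 0 ≤ x) (hxy : x ≤ y) : φ x ≤ φ y :=
  hφ.strictMonoOn.monotoneOn hx (hx.trans hxy) hxy

lemma exists_one_add_sq_le (hφ : IsWeightExponent φ) :
    ∃ C : ℝ, 0 < C ∧ ∀ x : ℝ, 1 + x ^ 2 ≤ C * Real.exp (φ |x| / 2) := by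
  -- Fourth powers, because `x²` is to be bounded by the square root of the weight.
  have h := (hφ.growth 4).eventually (gt_mem_nhds zero_lt_one)
  rw [Metric.cobounded_eq_cocompact.symm, ← comap_norm_atTop, eventually_comap] at h
  obtain ⟨T, hT⟩ := eventually_atTop.1 h
  refine ⟨2 + T ^ 2, by positivity, fun x => ?_⟩
  have h1 : 1 ≤ Real.exp (φ |x| / 2) :=
    Real.one_le_exp (by linarith [hφ.nonneg |x| (abs_nonneg x)])
  by_cases hx : T ≤ ‖x‖
  · have h2 := hT ‖x‖ hx x rfl
    rw [weight, div_lt_one (Real.exp_pos _)] at h2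
    have h3 : Real.exp (φ |x|) = Real.exp (φ |x| / 2) ^ 2 := by
      rw [← Real.exp_nat_mul]; congr 1; push_cast; ring
    have h4 : x ^ 2 ≤ Real.exp (φ |x| / 2) := by
      refine le_of_sq_le_sq ?_ (by positivity)
      nlinarith
    nlinarith [sq_nonneg T]
  · have h2 : x ^ 2 ≤ T ^ 2 := by
      have hlt := not_le.1 hx
      rw [Real.norm_eq_abs] at hlt
      rw [← sq_abs]
      gcongr
    nlinarith [sq_nonneg T]

lemma exists_le (hφ : IsWeightExponent φ) (B : ℝ) : ∃ x : ℝ, 1 ≤ x ∧ B ≤ φ x := by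
  obtain ⟨C, hC, h⟩ := hφ.exists_one_add_sq_le
  have hE := Real.exp_pos (B / 2)
  refine ⟨1 + C * Real.exp (B / 2), by nlinarith [mul_pos hC hE], ?_⟩
  have h1 := h (1 + C * Real.exp (B / 2))
  rw [abs_of_pos (by positivity)] at h1
  have h2 : C * Real.exp (B / 2) ≤ C * Real.exp (φ (1 + C * Real.exp (B / 2)) / 2) := by
    nlinarith [mul_pos hC hE]
  have := Real.exp_le_exp.1 (le_of_mul_le_mul_left h2 hC)
  linarith

end IsWeightExponent

end WeightedApprox

/-! ### The truncated integral as a dyadic sum -/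

namespace WeightedApprox

namespace IsWeightExponent

variable {φ : ℝ → ℝ}

lemma integrableOn_truncated (hφ : IsWeightExponent φ) (n : ℕ) :
    IntegrableOn (fun x : ℝ => min (φ (1 / x)) (n : ℝ)) (Ioc 0 1) := by
  have hc : ContinuousOn (fun x : ℝ => min (φ (1 / x)) (n : ℝ)) (Ioc 0 1) := by
    refine ContinuousOn.inf (hφ.continuousOn.comp ?_ fun x hx => ?_) continuousOn_const
    · exact continuousOn_const.div continuousOn_id fun x hx => hx.1.ne'
    · exact one_div_nonneg.2 hx.1.le
  refine IntegrableOn.of_bound (by simp) (hc.aestronglyMeasurable measurableSet_Ioc) n ?_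
  refine (ae_restrict_iff' measurableSet_Ioc).2 (Eventually.of_forall fun x hx => ?_)
  rw [Real.norm_of_nonneg (le_min (hφ.nonneg _ (one_div_nonneg.2 hx.1.le)) n.cast_nonneg)]
  exact min_le_right _ _

lemma intervalIntegrable_truncated (hφ : IsWeightExponent φ) (n : ℕ) {a b : ℝ} (ha : 0 ≤ a)
    (hab : a ≤ b) (hb : b ≤ 1) :
    IntervalIntegrable (fun x : ℝ => min (φ (1 / x)) (n : ℝ)) volume a b :=
  (intervalIntegrable_iff_integrableOn_Ioc_of_le hab).2
    ((hφ.integrableOn_truncated n).mono_set (Ioc_subset_Ioc ha hb))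

lemma le_integral_truncated (hφ : IsWeightExponent φ) (n : ℕ) {a b : ℝ} (ha : 0 ≤ a)
    (hab : a < b) (hb : b ≤ 1) :
    min (φ (1 / b)) n * (b - a) ≤ ∫ x in a..b, min (φ (1 / x)) (n : ℝ) := by
  have := intervalIntegral.integral_mono_on_of_le_Ioo hab.le
    (intervalIntegrable_const (c := min (φ (1 / b)) (n : ℝ)))
    (hφ.intervalIntegrable_truncated n ha hab.le hb) fun x hx => by
      have hx0 : 0 < x := ha.trans_lt hx.1
      have hxb := hx.2.le
      refine min_le_min_right _ (hφ.mono (one_div_nonneg.2 (hx0.le.trans hxb)) ?_)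
      gcongr
  rwa [intervalIntegral.integral_const, smul_eq_mul, mul_comm] at this

lemma integral_truncated_le (hφ : IsWeightExponent φ) (n : ℕ) {a b c : ℝ} (ha : 0 ≤ a)
    (hab : a < b) (hb : b ≤ 1) (hc : ∀ x, a < x → x < b → min (φ (1 / x)) n ≤ c) :
    ∫ x in a..b, min (φ (1 / x)) (n : ℝ) ≤ c * (b - a) := by
  have := intervalIntegral.integral_mono_on_of_le_Ioo hab.le
    (hφ.intervalIntegrable_truncated n ha hab.le hb)
    (intervalIntegrable_const (c := c)) fun x hx => hc x hx.1 hx.2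
  rwa [intervalIntegral.integral_const, smul_eq_mul, mul_comm _ c] at this

lemma truncatedIntegral_dyadic (hφ : IsWeightExponent φ) (n m : ℕ) :
    truncatedIntegral φ n = ∑ k ∈ Finset.range m,
      (∫ x in ((2 : ℝ) ^ (k + 1))⁻¹..((2 : ℝ) ^ k)⁻¹, min (φ (1 / x)) (n : ℝ)) +
      ∫ x in (0 : ℝ)..((2 : ℝ) ^ m)⁻¹, min (φ (1 / x)) (n : ℝ) := by
  induction m with
  | zero => simp [truncatedIntegral]
  | succ m ih =>
    have h1 : ((2 : ℝ) ^ m)⁻¹ ≤ 1 := inv_le_one_of_one_le₀ (one_le_pow₀ one_le_two)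
    have h2 : ((2 : ℝ) ^ (m + 1))⁻¹ ≤ ((2 : ℝ) ^ m)⁻¹ := by
      gcongr
      · exact one_le_two
      · exact m.le_succ
    rw [Finset.sum_range_succ, ih, add_assoc, add_comm (∫ x in ((2 : ℝ) ^ (m + 1))⁻¹.._, _),
      intervalIntegral.integral_add_adjacent_intervals
        (hφ.intervalIntegrable_truncated n le_rfl (by positivity) (h2.trans h1))
        (hφ.intervalIntegrable_truncated n (by positivity) h2 h1)]

/-- The integrand decreases in `x`, so on each dyadic interval it is bounded below by its value at
the right end; the companion upper bound uses the left end. -/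
lemma le_truncatedIntegral (hφ : IsWeightExponent φ) (n m : ℕ) :
    ∑ k ∈ Finset.range m, min (φ (2 ^ k)) n / 2 ^ (k + 1) + min (φ (2 ^ m)) n / 2 ^ m ≤
      truncatedIntegral φ n := by
  rw [hφ.truncatedIntegral_dyadic n m]
  gcongr with k hk
  · have h2 : ((2 : ℝ) ^ (k + 1))⁻¹ < ((2 : ℝ) ^ k)⁻¹ := by
      gcongr
      · exact one_lt_two
      · exact k.lt_succ_self
    have := hφ.le_integral_truncated n (by positivity) h2
      (inv_le_one_of_one_le₀ (one_le_pow₀ one_le_two))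
    rw [one_div, inv_inv] at this
    refine le_trans (le_of_eq ?_) this
    rw [pow_succ]
    field_simp
    ring
  · have := hφ.le_integral_truncated n le_rfl (b := ((2 : ℝ) ^ m)⁻¹) (by positivity)
      (inv_le_one_of_one_le₀ (one_le_pow₀ one_le_two))
    rwa [one_div, inv_inv, sub_zero, ← div_eq_mul_inv] at this

lemma truncatedIntegral_le (hφ : IsWeightExponent φ) (n m : ℕ) :
    truncatedIntegral φ n ≤
      ∑ k ∈ Finset.range m, min (φ (2 ^ (k + 1))) n / 2 ^ (k + 1) + n / 2 ^ m := by
  rw [hφ.truncatedIntegral_dyadic n m]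
  gcongr with k hk
  · have h2 : ((2 : ℝ) ^ (k + 1))⁻¹ < ((2 : ℝ) ^ k)⁻¹ := by
      gcongr
      · exact one_lt_two
      · exact k.lt_succ_self
    have := hφ.integral_truncated_le n (c := min (φ (2 ^ (k + 1))) n) (by positivity) h2
      (inv_le_one_of_one_le₀ (one_le_pow₀ one_le_two)) fun x hx _ => by
        have hx0 : 0 < x := lt_trans (by positivity) hx
        refine min_le_min_right _ (hφ.mono (by positivity) ?_)
        rw [one_div]
        exact inv_le_of_inv_le₀ (by positivity) hx.le
    refine this.trans (le_of_eq ?_)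
    rw [pow_succ]
    field_simp
    ring
  · have := hφ.integral_truncated_le n (c := n) le_rfl (b := ((2 : ℝ) ^ m)⁻¹) (by positivity)
      (inv_le_one_of_one_le₀ (one_le_pow₀ one_le_two)) fun x _ _ => min_le_right _ _
    rwa [sub_zero, ← div_eq_mul_inv] at this

lemma truncatedIntegral_mono (hφ : IsWeightExponent φ) : Monotone (truncatedIntegral φ) := by
  intro m n hmn
  refine intervalIntegral.integral_mono_on zero_le_one
    (hφ.intervalIntegrable_truncated m le_rfl zero_le_one le_rfl)
    (hφ.intervalIntegrable_truncated n le_rfl zero_le_one le_rfl) fun x _ => ?_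
  gcongr

lemma truncatedIntegral_pos (hφ : IsWeightExponent φ) {n : ℕ} (hn : 1 ≤ n) :
    0 < truncatedIntegral φ n := by
  have h := hφ.le_truncatedIntegral n 0
  simp only [Finset.range_zero, Finset.sum_empty, pow_zero, div_one, zero_add] at h
  refine lt_of_lt_of_le (lt_min ?_ (by exact_mod_cast hn)) h
  exact (hφ.nonneg 0 le_rfl).trans_lt (hφ.strictMonoOn (by simp) (by simp) zero_lt_one)

lemma lintegral_log_weight_le (hφ : IsWeightExponent φ) :
    ∫⁻ t : ℝ, ENNReal.ofReal (Real.log (weight φ t) / (1 + t ^ 2)) ≤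
      ∑' k : ℕ, ENNReal.ofReal (8 * (φ (2 ^ (k + 1)) / 2 ^ (k + 1))) := by
  -- Overlapping shells: the condition `4 ^ k ≤ 1 + t ^ 2` rather than `2 ^ k ≤ |t|` lets `k = 0`
  -- also cover `|t| ≤ 1`.
  set S : ℕ → Set ℝ := fun k => {t | |t| ≤ 2 ^ (k + 1) ∧ 4 ^ k ≤ 1 + t ^ 2} with hS
  have hcover : ⋃ k, S k = univ := by
    refine eq_univ_of_forall fun t => mem_iUnion.2 ?_
    rcases le_total 1 |t| with h | h
    · obtain ⟨k, hk1, hk2⟩ := exists_nat_pow_near h (one_lt_two : (1 : ℝ) < 2)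
      refine ⟨k, hk2.le, ?_⟩
      have : (4 : ℝ) ^ k = (2 ^ k) ^ 2 := by rw [← pow_mul, mul_comm, pow_mul]; norm_num
      rw [this, ← sq_abs t]
      have : ((2 : ℝ) ^ k) ^ 2 ≤ |t| ^ 2 := by gcongr
      linarith
    · refine ⟨0, ?_, ?_⟩
      · rw [zero_add, pow_one]; linarith
      · rw [pow_zero]; nlinarith
  have hmeas : ∀ k, MeasurableSet (S k) := fun k => by
    have h1 : MeasurableSet {t : ℝ | |t| ≤ 2 ^ (k + 1)} :=
      measurableSet_le (by fun_prop) (by fun_prop)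
    have h2 : MeasurableSet {t : ℝ | (4 : ℝ) ^ k ≤ 1 + t ^ 2} :=
      measurableSet_le (by fun_prop) (by fun_prop)
    exact h1.inter h2
  rw [← setLIntegral_univ, ← hcover]
  refine (lintegral_iUnion_le _ _).trans (ENNReal.tsum_le_tsum fun k => ?_)
  have hpos : 0 ≤ φ (2 ^ (k + 1)) := hφ.nonneg _ (by positivity)
  calc ∫⁻ t in S k, ENNReal.ofReal (Real.log (weight φ t) / (1 + t ^ 2))
      ≤ ∫⁻ _ in S k, ENNReal.ofReal (φ (2 ^ (k + 1)) / 4 ^ k) := by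
        refine setLIntegral_mono' (hmeas k) fun t ht => ENNReal.ofReal_le_ofReal ?_
        rw [weight, Real.log_exp]
        have h1 := hφ.mono (abs_nonneg t) ht.1
        have h2 := ht.2
        gcongr
    _ = ENNReal.ofReal (φ (2 ^ (k + 1)) / 4 ^ k) * volume (S k) := by
        rw [setLIntegral_const]
    _ ≤ ENNReal.ofReal (φ (2 ^ (k + 1)) / 4 ^ k) *
          volume (Icc (-(2 : ℝ) ^ (k + 1)) (2 ^ (k + 1))) := by
        gcongr
        exact fun t ht => abs_le.1 ht.1
    _ = _ := by
        rw [Real.volume_Icc, ← ENNReal.ofReal_mul (by positivity)]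
        congr 1
        have : (4 : ℝ) ^ k = 2 ^ k * 2 ^ k := by rw [← mul_pow]; norm_num
        rw [this, pow_succ]
        field_simp
        ring

/-- If `I_n` stayed bounded, `∑ φ(2^k) / 2^k` would converge, and with it the logarithmic integral.
-/
lemma tendsto_truncatedIntegral (hφ : IsWeightExponent φ) :
    Tendsto (truncatedIntegral φ) atTop atTop := by
  refine tendsto_atTop_atTop_of_monotone hφ.truncatedIntegral_mono fun b => ?_
  by_contra! hcon
  have hsum : ∀ m : ℕ, ∑ k ∈ Finset.range m, φ (2 ^ k) / 2 ^ k ≤ 2 * b := by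
    intro m
    obtain ⟨n, hn⟩ := exists_nat_ge (φ (2 ^ m))
    have h1 := (hφ.le_truncatedIntegral n m).trans (hcon n).le
    have h2 : 0 ≤ min (φ (2 ^ m)) (n : ℝ) / 2 ^ m :=
      div_nonneg (le_min (hφ.nonneg _ (by positivity)) n.cast_nonneg) (by positivity)
    have h3 : ∑ k ∈ Finset.range m, φ (2 ^ k) / 2 ^ k =
        2 * ∑ k ∈ Finset.range m, min (φ (2 ^ k)) (n : ℝ) / 2 ^ (k + 1) := by
      rw [Finset.mul_sum]
      refine Finset.sum_congr rfl fun k hk => ?_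
      have : φ (2 ^ k) ≤ n := (hφ.mono (by positivity)
        (pow_le_pow_right₀ one_le_two (Finset.mem_range.1 hk).le)).trans hn
      rw [min_eq_left this, pow_succ]
      field_simp
    linarith
  have hnn : ∀ k : ℕ, 0 ≤ φ (2 ^ k) / 2 ^ k := fun k =>
    div_nonneg (hφ.nonneg _ (by positivity)) (by positivity)
  have hs : Summable fun k : ℕ => φ (2 ^ k) / 2 ^ k := summable_of_sum_range_le hnn hsum
  have hs' : Summable fun k : ℕ => 8 * (φ (2 ^ (k + 1)) / 2 ^ (k + 1)) :=
    ((summable_nat_add_iff 1).2 hs).mul_left 8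
  have := hφ.lintegral_log_weight_le
  rw [hφ.log_integral, top_le_iff] at this
  exact hs'.tsum_ofReal_ne_top this

end IsWeightExponent

end WeightedApprox

/-! ### The lower bound for `E_n` -/

namespace WeightedApprox

namespace IsWeightExponent

variable {φ : ℝ → ℝ}

lemma exists_dyadic (hφ : IsWeightExponent φ) {y : ℝ} (h : φ 1 ≤ y) :
    ∃ K : ℕ, φ (2 ^ K) ≤ y ∧ y < φ (2 ^ (K + 1)) := by
  have hex : ∃ k : ℕ, y < φ (2 ^ k) := by
    obtain ⟨x, hx, hy⟩ := hφ.exists_le (y + 1)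
    obtain ⟨k, hk⟩ := pow_unbounded_of_one_lt x (one_lt_two : (1 : ℝ) < 2)
    exact ⟨k, by linarith [hφ.mono (by linarith) hk.le]⟩
  classical
  have h0 : Nat.find hex ≠ 0 := fun h0 => by
    have := Nat.find_spec hex
    rw [h0, pow_zero] at this
    linarith
  obtain ⟨K, hK⟩ := Nat.exists_eq_succ_of_ne_zero h0
  refine ⟨K, not_lt.1 (Nat.find_min hex (by omega)), ?_⟩
  have := Nat.find_spec hex
  rwa [hK] at this

lemma le_add_sum_steps (hφ : IsWeightExponent φ) (K : ℕ) {x : ℝ} (hx0 : 0 ≤ x)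
    (hx : x ≤ 2 ^ K) :
    φ x ≤ φ 1 + ∑ k ∈ Finset.range K,
      (if (2 : ℝ) ^ k ≤ x then φ (2 ^ (k + 1)) - φ (2 ^ k) else 0) := by
  have hnn : ∀ k : ℕ, 0 ≤ φ (2 ^ (k + 1)) - φ (2 ^ k) := fun k =>
    sub_nonneg.2 (hφ.mono (by positivity) (pow_le_pow_right₀ one_le_two k.le_succ))
  have hnn' : ∀ k : ℕ, 0 ≤ if (2 : ℝ) ^ k ≤ x then φ (2 ^ (k + 1)) - φ (2 ^ k) else 0 :=
    fun k => by split_ifs <;> [exact hnn k; exact le_rfl]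
  rcases le_total x 1 with h1 | h1
  · linarith [hφ.mono hx0 h1, Finset.sum_nonneg fun k (_ : k ∈ Finset.range K) => hnn' k]
  obtain ⟨j, hj1, hj2⟩ := exists_nat_pow_near h1 (one_lt_two : (1 : ℝ) < 2)
  -- The minimum matters at `x = 2 ^ K`, where `j = K` but only `K` steps are available.
  have hm : x ≤ 2 ^ min (j + 1) K := by
    rcases min_choice (j + 1) K with h | h <;> rw [h] <;> [exact hj2.le; exact hx]
  have hsub : ∑ k ∈ Finset.range (min (j + 1) K), (φ (2 ^ (k + 1)) - φ (2 ^ k)) ≤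
      ∑ k ∈ Finset.range K,
        (if (2 : ℝ) ^ k ≤ x then φ (2 ^ (k + 1)) - φ (2 ^ k) else 0) := by
    refine le_trans (le_of_eq (Finset.sum_congr rfl fun k hk => ?_))
      (Finset.sum_le_sum_of_subset_of_nonneg
        (Finset.range_subset_range.2 (min_le_right (j + 1) K)) fun k _ _ => hnn' k)
    have hk' : k ≤ j := by
      have := Finset.mem_range.1 hk
      omega
    rw [if_pos ((pow_le_pow_right₀ one_le_two hk').trans hj1)]
  rw [Finset.sum_range_sub (fun k => φ (2 ^ k)), pow_zero] at hsub
  linarith [hφ.mono hx0 hm]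

theorem exists_cauchyError_ge (hφ : IsWeightExponent φ) :
    ∃ N : ℕ, ∀ p : ℝ≥0∞, 1 ≤ p → ∀ n : ℕ, N ≤ n →
      ENNReal.ofReal (Real.exp (-(21 * truncatedIntegral φ n))) ≤
        cauchyError p (weight φ) n := by
  -- From this `N` on, one of the 21 copies of `I_n` pays for the constant `32 π e^{φ(1)}`; the
  -- other 20 pay for the degree and the steps.
  obtain ⟨N, hN⟩ := (hφ.tendsto_truncatedIntegral.eventually_ge_atTop
    (Real.log (32 * Real.pi) + φ 1)).exists_forall_of_atTop
  obtain ⟨N', hN'⟩ := exists_nat_ge (φ 1)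
  refine ⟨max N N', fun p hp n hn => ?_⟩
  have hnN := hN n (le_of_max_le_left hn)
  have hn1 : φ 1 ≤ n := hN'.trans (by exact_mod_cast le_of_max_le_right hn)
  obtain ⟨K, hK1, hK2⟩ := hφ.exists_dyadic hn1
  have hc : ∀ k : ℕ, 0 ≤ φ (2 ^ (k + 1)) - φ (2 ^ k) := fun k =>
    sub_nonneg.2 (hφ.mono (by positivity) (pow_le_pow_right₀ one_le_two k.le_succ))
  have hpos : ∀ k : ℕ, 0 ≤ φ (2 ^ k) := fun k => hφ.nonneg _ (by positivity)
  -- Splitting at `K + 1`, where `φ` exceeds `n`, makes the last term exactly `n / 2 ^ (K + 1)`,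
  -- comparable with the cost `2n / R` of the degree.
  have hI := hφ.le_truncatedIntegral n (K + 1)
  rw [min_eq_right hK2.le] at hI
  have hsum : ∑ k ∈ Finset.range (K + 1), min (φ (2 ^ k)) (n : ℝ) / 2 ^ (k + 1) =
      ∑ k ∈ Finset.range (K + 1), φ (2 ^ k) / 2 ^ (k + 1) := by
    refine Finset.sum_congr rfl fun k hk => ?_
    rw [min_eq_left ((hφ.mono (by positivity) (pow_le_pow_right₀ one_le_two
      (Nat.lt_succ_iff.1 (Finset.mem_range.1 hk)))).trans hK1)]
  have hS : ∑ k ∈ Finset.range K, (φ (2 ^ (k + 1)) - φ (2 ^ k)) / 2 ^ k ≤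
      4 * ∑ k ∈ Finset.range (K + 1), φ (2 ^ k) / 2 ^ (k + 1) := by
    rw [Finset.sum_range_succ', mul_add, Finset.mul_sum]
    have h0 : 0 ≤ 4 * (φ (2 ^ 0) / 2 ^ (0 + 1)) := by have := hpos 0; positivity
    refine (Finset.sum_le_sum fun k _ => ?_).trans (le_add_of_nonneg_right h0)
    have h1 : φ (2 ^ (k + 1)) - φ (2 ^ k) ≤ φ (2 ^ (k + 1)) := by linarith [hpos k]
    calc _ ≤ φ (2 ^ (k + 1)) / 2 ^ k := by gcongr
      _ = _ := by rw [pow_succ (2 : ℝ) (k + 1), pow_succ (2 : ℝ) k]; field_simp; norm_num; ring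
  have hS0 : 0 ≤ ∑ k ∈ Finset.range (K + 1), φ (2 ^ k) / 2 ^ (k + 1) :=
    Finset.sum_nonneg fun k _ => div_nonneg (hpos k) (by positivity)
  have hnK : 2 * (n : ℝ) / 2 ^ K = 4 * (n / 2 ^ (K + 1)) := by
    rw [pow_succ]; field_simp; norm_num; ring
  have hn0 : 0 ≤ (n : ℝ) / 2 ^ (K + 1) := by positivity
  have hexp : -(20 * truncatedIntegral φ n) ≤ -(2 * n / 2 ^ K) -
      4 * ∑ k ∈ Finset.range K, (φ (2 ^ (k + 1)) - φ (2 ^ k)) / 2 ^ k := by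
    rw [hnK]
    linarith
  refine le_trans (ENNReal.ofReal_le_ofReal ?_)
    (le_cauchyError_of_polynomial (R := 2 ^ K) hp hφ.continuous_weight (fun x => Real.exp_pos _)
      (by positivity) (a := Real.exp (-(20 * truncatedIntegral φ n)) / (32 * Real.exp (φ 1)))
      fun P hP hPI => ?_)
  · have h32 : 32 * Real.pi * Real.exp (φ 1) ≤ Real.exp (truncatedIntegral φ n) := by
      rw [← Real.exp_log (show 0 < 32 * Real.pi by positivity), ← Real.exp_add]
      exact Real.exp_le_exp.2 hnN
    rw [div_div, le_div_iff₀ (by positivity)]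
    calc _ = Real.exp (-(21 * truncatedIntegral φ n)) * (32 * Real.pi * Real.exp (φ 1)) := by
          ring
      _ ≤ Real.exp (-(21 * truncatedIntegral φ n)) * Real.exp (truncatedIntegral φ n) := by
          gcongr
      _ = _ := by rw [← Real.exp_add]; congr 1; ring
  · have := norm_eval_I_le_integral hP (R := 2 ^ K) (one_le_pow₀ one_le_two) K
      (c := fun k => φ (2 ^ (k + 1)) - φ (2 ^ k)) (t := fun k => 2 ^ k) hc
      (fun k => by positivity) hφ.continuous_comp_abs (B := φ 1)
      fun x hx => hφ.le_add_sum_steps K (abs_nonneg x) hx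
    rw [hPI, norm_one, mul_one] at this
    rw [div_le_iff₀' (by positivity)]
    exact (Real.exp_le_exp.2 hexp).trans this

end IsWeightExponent

end WeightedApprox

/-! ### Large polynomials under rapid growth -/

namespace WeightedApprox

section

open Complex Polynomial

/-- Taylor polynomials of `exp (-i a z)`. -/
lemma exists_exp_section (n : ℕ) {a : ℝ} (ha : 0 ≤ a) :
    ∃ P : ℂ[X], P.natDegree ≤ n ∧ (∀ x : ℝ, a * |x| ≤ n / 4 → ‖P.eval (x : ℂ)‖ ≤ 3) ∧
      (∀ x : ℝ, ‖P.eval (x : ℂ)‖ ≤ Real.exp (a * |x|)) ∧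
      (a ≤ n / 4 → Real.exp a - 2 ≤ ‖P.eval I‖) := by
  set P : ℂ[X] := ∑ k ∈ Finset.range (n + 1), Polynomial.monomial k ((-I * a) ^ k / (k.factorial : ℂ))
    with hP
  have heval : ∀ z : ℂ, P.eval z =
      ∑ k ∈ Finset.range (n + 1), (-I * a * z) ^ k / (k.factorial : ℂ) := fun z => by
    rw [hP, Polynomial.eval_finsetSum]
    refine Finset.sum_congr rfl fun k _ => ?_
    rw [Polynomial.eval_monomial, mul_pow _ z]
    ring
  have herr : ∀ z : ℂ, ‖z‖ ≤ n / 4 →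
      ‖cexp z - ∑ k ∈ Finset.range (n + 1), z ^ k / (k.factorial : ℂ)‖ ≤ 2 := fun z hz => by
    refine (Complex.exp_bound' (n := n + 1) ?_).trans ?_
    · rw [div_le_iff₀ (by positivity)]
      push_cast
      linarith [n.cast_nonneg (α := ℝ)]
    -- The range `|z| ≤ n / 4` is what this needs: `(n+1)^(n+1) / (n+1)! ≤ e^(n+1) ≤ 4^(n+1)`.
    · have h1 : ‖z‖ ^ (n + 1) / (n + 1).factorial ≤ 1 := by
        have h2 := Real.pow_div_factorial_le_exp (x := ((n + 1 : ℕ) : ℝ)) (by positivity) (n + 1)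
        have h3 : Real.exp ((n + 1 : ℕ) : ℝ) ≤ 4 ^ (n + 1) := by
          rw [← mul_one ((n + 1 : ℕ) : ℝ), Real.exp_nat_mul]
          have := Real.exp_one_lt_d9
          gcongr
          linarith
        calc ‖z‖ ^ (n + 1) / (n + 1).factorial
            ≤ (((n + 1 : ℕ) : ℝ) / 4) ^ (n + 1) / (n + 1).factorial := by
              gcongr
              refine hz.trans ?_
              push_cast
              linarith
          _ = ((n + 1 : ℕ) : ℝ) ^ (n + 1) / (n + 1).factorial / 4 ^ (n + 1) := by
              rw [div_pow]; ring
          _ ≤ 1 := by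
              rw [div_le_one (by positivity)]
              exact h2.trans h3
      linarith
  have hnorm : ∀ x : ℝ, ‖(-I * a * x : ℂ)‖ = a * |x| := fun x => by
    simp [abs_of_nonneg ha]
  refine ⟨P, ?_, fun x hx => ?_, fun x => ?_, fun han => ?_⟩
  · refine Polynomial.natDegree_sum_le_of_forall_le _ _ fun k hk => ?_
    exact (Polynomial.natDegree_monomial_le _).trans (Nat.lt_succ_iff.1 (Finset.mem_range.1 hk))
  · have h1 := herr (-I * a * x) (by rwa [hnorm])
    rw [← heval] at h1
    have h2 : ‖cexp (-I * a * x)‖ = 1 := by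
      rw [Complex.norm_exp]; simp
    have h3 := norm_sub_norm_le (P.eval (x : ℂ)) (cexp (-I * a * x))
    rw [norm_sub_rev] at h3
    linarith
  · rw [heval]
    refine (norm_sum_le _ _).trans ?_
    refine le_trans (le_of_eq ?_)
      (Real.sum_le_exp_of_nonneg (mul_nonneg ha (abs_nonneg x)) (n + 1))
    refine Finset.sum_congr rfl fun k _ => ?_
    rw [norm_div, norm_pow, hnorm]
    simp
  · have e : (-I * a * I : ℂ) = a := by linear_combination (-(a : ℂ)) * I_sq
    have h1 := herr (-I * a * I) (by rw [e]; simpa [abs_of_nonneg ha] using han)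
    rw [← heval, e] at h1
    have h2 := norm_sub_norm_le (cexp a) (P.eval I)
    have h3 : ‖cexp a‖ = Real.exp a := by rw [Complex.norm_exp]; simp
    linarith

end

/-- For large `n` there are polynomials of degree at most `n`, bounded by `W ^ (1/2)` up to a
constant on the real line, whose modulus at `i` is at least `exp (c I_n)` up to a constant. -/
def HasLargePolynomials (φ : ℝ → ℝ) : Prop :=
  ∃ c : ℝ, 0 < c ∧ ∃ (B : ℝ) (N : ℕ), ∀ n : ℕ, N ≤ n → ∃ P : Polynomial ℂ, P.natDegree ≤ n ∧
    (∀ x : ℝ, ‖P.eval (x : ℂ)‖ ≤ Real.exp (B + φ |x| / 2)) ∧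
    Real.exp (c * truncatedIntegral φ n - B) ≤ ‖P.eval Complex.I‖

namespace IsWeightExponent

variable {φ : ℝ → ℝ}

/-- For `1 / R ≤ x ≤ 1 / A` the growth condition gives `φ(1/x) ≤ n (R x)^(-(1+ε))`, whose integral
is dominated by the end `x = 1 / R`. -/
lemma truncatedIntegral_le_of_rapid (hφ : IsWeightExponent φ) {ε A R : ℝ} {n : ℕ} (hε : 0 < ε)
    (hA : 1 ≤ A) (hmono : MonotoneOn (fun x => φ x / x ^ (1 + ε)) (Ici A)) (hR : A ≤ R)
    (hRn : φ R = n) : truncatedIntegral φ n ≤ φ A + (1 + 1 / ε) * (n / R) := by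
  have hA0 : 0 < A := by linarith
  have hR0 : 0 < R := by linarith
  have hRA : R⁻¹ ≤ A⁻¹ := by gcongr
  have hA1 : A⁻¹ ≤ 1 := inv_le_one_of_one_le₀ hA
  have hRi : 0 < R⁻¹ := by positivity
  have hAi : 0 < A⁻¹ := by positivity
  have hφA := hφ.nonneg A hA0.le
  have i1 := hφ.intervalIntegrable_truncated n le_rfl hRi.le (hRA.trans hA1)
  have i2 := hφ.intervalIntegrable_truncated n hRi.le hRA hA1
  have i3 := hφ.intervalIntegrable_truncated n hAi.le hA1 le_rfl
  have h1 : ∫ x in (0 : ℝ)..R⁻¹, min (φ (1 / x)) (n : ℝ) ≤ n / R := by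
    have := hφ.integral_truncated_le n (c := n) le_rfl hRi (hRA.trans hA1)
      fun x _ _ => min_le_right _ _
    rwa [sub_zero, ← div_eq_mul_inv] at this
  have h3 : ∫ x in A⁻¹..1, min (φ (1 / x)) (n : ℝ) ≤ φ A := by
    rcases hA1.eq_or_lt with h | h
    · rw [h, intervalIntegral.integral_same]; exact hφA
    refine (hφ.integral_truncated_le n (c := φ A) hAi.le h le_rfl fun x hx _ => ?_).trans ?_
    · refine (min_le_left _ _).trans (hφ.mono ?_ ?_)
      · exact one_div_nonneg.2 (hAi.trans hx).le
      · rw [one_div]; exact inv_le_of_inv_le₀ hA0 hx.le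
    · nlinarith
  have h2 : ∫ x in R⁻¹..A⁻¹, min (φ (1 / x)) (n : ℝ) ≤ 1 / ε * (n / R) := by
    have h0 : (0 : ℝ) ∉ uIcc R⁻¹ A⁻¹ := by
      rw [uIcc_of_le hRA]
      exact fun h => absurd h.1 (not_le.2 hRi)
    have hle : ∫ x in R⁻¹..A⁻¹, min (φ (1 / x)) (n : ℝ) ≤
        ∫ x in R⁻¹..A⁻¹, n / R ^ (1 + ε) * x ^ (-(1 + ε)) := by
      refine intervalIntegral.integral_mono_on hRA i2
        ((intervalIntegral.intervalIntegrable_rpow (Or.inr h0)).const_mul _) fun x hx => ?_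
      have hx0 : 0 < x := hRi.trans_le hx.1
      have hxA : A ≤ 1 / x := by
        rw [one_div]; exact le_inv_of_le_inv₀ hx0 hx.2
      have hxR : 1 / x ≤ R := by
        rw [one_div]; exact inv_le_of_inv_le₀ hR0 hx.1
      have := hmono (mem_Ici.2 hxA) (mem_Ici.2 hR) hxR
      simp only [hRn] at this
      rw [div_le_iff₀ (Real.rpow_pos_of_pos (by positivity) _)] at this
      refine (min_le_left _ _).trans (this.trans (le_of_eq ?_))
      rw [one_div, Real.inv_rpow hx0.le, Real.rpow_neg hx0.le]
    refine hle.trans ?_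
    rw [intervalIntegral.integral_const_mul, integral_rpow (Or.inr ⟨by linarith, h0⟩)]
    have e1 : -(1 + ε) + 1 = -ε := by ring
    have e2 : (R⁻¹ : ℝ) ^ (-ε) = R ^ ε := by
      rw [Real.inv_rpow hR0.le, Real.rpow_neg hR0.le, inv_inv]
    have e3 : R ^ (1 + ε) = R * R ^ ε := by rw [Real.rpow_add hR0, Real.rpow_one]
    rw [e1, e2, e3]
    have hRε := Real.rpow_pos_of_pos hR0 ε
    have hAε := Real.rpow_pos_of_pos hAi (-ε)
    have hn : (0 : ℝ) ≤ n := n.cast_nonneg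
    calc n / (R * R ^ ε) * ((A⁻¹ ^ (-ε) - R ^ ε) / -ε)
        = n / (R * R ^ ε) * ((R ^ ε - A⁻¹ ^ (-ε)) / ε) := by
          rw [div_neg, ← neg_div, neg_sub]
      _ ≤ n / (R * R ^ ε) * (R ^ ε / ε) := by
          gcongr
          linarith
      _ = 1 / ε * (n / R) := by field_simp
  have hsplit : truncatedIntegral φ n = (∫ x in (0 : ℝ)..R⁻¹, min (φ (1 / x)) (n : ℝ)) +
      (∫ x in R⁻¹..A⁻¹, min (φ (1 / x)) (n : ℝ)) + ∫ x in A⁻¹..1, min (φ (1 / x)) (n : ℝ) := by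
    rw [intervalIntegral.integral_add_adjacent_intervals i1 i2,
      intervalIntegral.integral_add_adjacent_intervals (i1.trans i2) i3, truncatedIntegral]
  rw [hsplit]
  linarith

/-- The Taylor section is bounded for `|x| ≤ R`. Beyond `R`, `φ(x) / x ≥ n / R`, so even the trivial
bound `exp(a|x|)` is at most `exp(φ(|x|) / 4)`. -/
theorem hasLargePolynomials_of_rapid (hφ : IsWeightExponent φ) (h : RapidlyGrowing φ) :
    HasLargePolynomials φ := by
  obtain ⟨ε, hε, A₀, -, hmono₀⟩ := h
  set A := max A₀ 1 with hAdef
  have hA : 1 ≤ A := le_max_right _ _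
  have hmono : MonotoneOn (fun x => φ x / x ^ (1 + ε)) (Ici A) :=
    hmono₀.mono (Ici_subset_Ici.2 (le_max_left _ _))
  have hφA := hφ.nonneg A (by linarith)
  set C := 4 * (1 + 1 / ε) with hC
  have hC0 : 0 < C := by positivity
  obtain ⟨N, hN⟩ := (hφ.tendsto_truncatedIntegral.eventually_ge_atTop
    (φ A + 2 * C)).exists_forall_of_atTop
  obtain ⟨N', hN'⟩ := exists_nat_ge (φ A)
  refine ⟨C⁻¹, by positivity, 2 + φ A / C, max N N', fun n hn => ?_⟩
  have hnN := hN n (le_of_max_le_left hn)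
  have hnA : φ A ≤ n := hN'.trans (by exact_mod_cast le_of_max_le_right hn)
  obtain ⟨R, hAR, hRn⟩ : ∃ R, A ≤ R ∧ φ R = n := by
    obtain ⟨x, hx1, hx⟩ := hφ.exists_le (max (n : ℝ) (φ A + 1))
    have hAx : A ≤ x := by
      by_contra hcon
      have := hφ.mono (by linarith) (not_le.1 hcon).le
      linarith [le_of_max_le_right hx]
    obtain ⟨R, hR, hRn⟩ := intermediate_value_Icc hAx
      (hφ.continuousOn.mono fun y hy => mem_Ici.2 (by linarith [hy.1])) ⟨hnA, le_of_max_le_left hx⟩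
    exact ⟨R, hR.1, hRn⟩
  have hR0 : 0 < R := by linarith
  have hI := hφ.truncatedIntegral_le_of_rapid hε hA hmono hAR hRn
  set a := n / (4 * R) with ha
  have ha0 : 0 ≤ a := by positivity
  have hIa : truncatedIntegral φ n ≤ φ A + C * a := by
    refine hI.trans (le_of_eq ?_)
    rw [hC, ha]; field_simp
  obtain ⟨P, hP, hP1, hP2, hP3⟩ := exists_exp_section n ha0
  have ha2 : 2 ≤ a := by
    by_contra hcon
    nlinarith
  have haR : a * R = n / 4 := by rw [ha]; field_simp
  have hφAC : 0 ≤ φ A / C := by positivity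
  refine ⟨P, hP, fun x => ?_, ?_⟩
  · have hx0 := hφ.nonneg |x| (abs_nonneg x)
    rcases le_total |x| R with hx | hx
    · refine (hP1 x ?_).trans ?_
      · rw [← haR]; gcongr
      · have h3 : (3 : ℝ) ≤ Real.exp 2 := by linarith [Real.add_one_le_exp (2 : ℝ)]
        exact h3.trans (Real.exp_le_exp.2 (by linarith))
    · refine (hP2 x).trans (Real.exp_le_exp.2 ?_)
      have h1 := hmono (mem_Ici.2 hAR) (mem_Ici.2 (hAR.trans hx)) hx
      have hx' : 0 < |x| := by linarith
      simp only [hRn] at h1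
      rw [Real.rpow_add hR0, Real.rpow_add hx', Real.rpow_one, Real.rpow_one] at h1
      have h2 : R ^ ε ≤ |x| ^ ε := Real.rpow_le_rpow hR0.le hx hε.le
      have hRε := Real.rpow_pos_of_pos hR0 ε
      have hxε := Real.rpow_pos_of_pos hx' ε
      have h4 : (n : ℝ) / R ≤ φ |x| / |x| := by
        have : (n : ℝ) / R / R ^ ε ≤ φ |x| / |x| / R ^ ε := by
          rw [div_div, div_div (φ |x|)]
          refine h1.trans ?_
          gcongr
        exact (div_le_div_iff_of_pos_right hRε).1 this
      rw [le_div_iff₀ hx'] at h4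
      have h5 : a * |x| = n / R * |x| / 4 := by rw [ha]; field_simp
      linarith
  · have ha4 : a ≤ n / 4 := by
      rw [← haR]
      nlinarith
    refine le_trans ?_ (hP3 ha4)
    have h1 : C⁻¹ * truncatedIntegral φ n ≤ φ A / C + a := by
      rw [inv_mul_le_iff₀ hC0]
      refine hIa.trans (le_of_eq ?_)
      field_simp
    have h2 : Real.exp (C⁻¹ * truncatedIntegral φ n - (2 + φ A / C)) ≤ Real.exp (a - 2) :=
      Real.exp_le_exp.2 (by linarith)
    have h3 : Real.exp a = Real.exp (a - 2) * Real.exp 2 := by rw [← Real.exp_add]; ring_nf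
    have h4 : (3 : ℝ) ≤ Real.exp 2 := by linarith [Real.add_one_le_exp (2 : ℝ)]
    have h5 : (1 : ℝ) ≤ Real.exp (a - 2) := Real.one_le_exp (by linarith)
    nlinarith

end IsWeightExponent

end WeightedApprox

/-! ### Large polynomials under normal growth -/

namespace WeightedApprox

section QuadraticFactor

open Complex Polynomial

/-- The second Taylor polynomial of `exp (-i z / b)`. -/
noncomputable def expQuadratic (b : ℝ) : ℂ[X] :=
  1 - C (I / b) * X - C (1 / (2 * b ^ 2) : ℂ) * X ^ 2

lemma natDegree_expQuadratic_le (b : ℝ) : (expQuadratic b).natDegree ≤ 2 := by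
  unfold expQuadratic
  compute_degree

/-- The `x²` terms cancel because `exp(-ix/b)` is unimodular. The resulting fourth-order smallness
is essential: multiplicities may grow like `4^k`, and the far factors are summable only because each
costs `O(16^(-k))`. -/
lemma sq_norm_eval_expQuadratic {b : ℝ} (hb : 0 < b) (x : ℝ) :
    ‖(expQuadratic b).eval (x : ℂ)‖ ^ 2 = 1 + x ^ 4 / (4 * b ^ 4) := by
  have e : (expQuadratic b).eval (x : ℂ) = ((1 - x ^ 2 / (2 * b ^ 2) : ℝ) : ℂ) +
      ((-(x / b) : ℝ) : ℂ) * I := by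
    simp only [expQuadratic, eval_sub, eval_one, eval_mul, eval_C, eval_X, eval_pow]
    push_cast
    ring
  rw [e, ← normSq_eq_norm_sq, normSq_add_mul_I]
  field_simp
  ring

lemma exp_le_norm_eval_I_expQuadratic {b : ℝ} (hb : 1 ≤ b) :
    Real.exp (1 / (2 * b)) ≤ ‖(expQuadratic b).eval I‖ := by
  have hb0 : 0 < b := by linarith
  have hbc : (b : ℂ) ≠ 0 := by exact_mod_cast hb0.ne'
  have e : (expQuadratic b).eval I = ((1 + 1 / b + 1 / (2 * b ^ 2) : ℝ) : ℂ) := by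
    simp only [expQuadratic, eval_sub, eval_one, eval_mul, eval_C, eval_X, eval_pow]
    push_cast
    field_simp
    linear_combination (-(2 * b : ℂ) - 1) * I_sq
  rw [e, Complex.norm_real, Real.norm_of_nonneg (by positivity)]
  set y := 1 / (2 * b) with hy
  have hy0 : 0 < y := by positivity
  have hy1 : y ≤ 1 / 2 := by rw [hy, div_le_div_iff₀ (by positivity) (by norm_num)]; linarith
  have h1 : 1 - y ≤ Real.exp (-y) := by linarith [Real.add_one_le_exp (-y)]
  have h2 : Real.exp (-y) * Real.exp y = 1 := by rw [← Real.exp_add]; simp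
  have h3 : 1 / b = 2 * y := by rw [hy]; field_simp
  have h4 : 0 ≤ 1 / (2 * b ^ 2) := by positivity
  rw [h3]
  nlinarith [Real.exp_pos y]

lemma norm_expQuadratic_le_of_le {b x : ℝ} (hb : 0 < b) {m : ℕ} (hx : |x| ≤ 2 ^ (m + 1) * b) :
    ‖(expQuadratic b).eval (x : ℂ)‖ ≤ Real.exp (2 * (m + 1 : ℕ)) := by
  have h1 : ‖(expQuadratic b).eval (x : ℂ)‖ ^ 2 ≤ (4 ^ (m + 1)) ^ 2 := by
    rw [sq_norm_eval_expQuadratic hb]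
    have hx4 : x ^ 4 ≤ 16 ^ (m + 1) * b ^ 4 := by
      calc x ^ 4 = |x| ^ 4 := by rw [← abs_pow, abs_of_nonneg (by positivity)]
        _ ≤ (2 ^ (m + 1) * b) ^ 4 := by gcongr
        _ = _ := by rw [mul_pow, ← pow_mul, mul_comm (m + 1), pow_mul]; norm_num
    have h16 : (16 : ℝ) ≤ 16 ^ (m + 1) := by
      simpa using pow_le_pow_right₀ (show (1 : ℝ) ≤ 16 by norm_num) (Nat.le_add_left 1 m)
    have h2 : x ^ 4 / (4 * b ^ 4) ≤ 16 ^ (m + 1) / 4 := by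
      rw [div_le_div_iff₀ (by positivity) (by norm_num)]
      linarith
    have h3 : ((4 : ℝ) ^ (m + 1)) ^ 2 = 16 ^ (m + 1) := by
      rw [← pow_mul, mul_comm, pow_mul]; norm_num
    rw [h3]
    linarith
  refine (le_of_sq_le_sq h1 (by positivity)).trans ?_
  rw [mul_comm, Real.exp_nat_mul]
  have h4 : (4 : ℝ) ≤ Real.exp 2 := by
    have := Real.add_one_le_exp (1 : ℝ)
    have h5 : Real.exp 2 = Real.exp 1 * Real.exp 1 := by rw [← Real.exp_add]; norm_num
    nlinarith
  gcongr

lemma norm_expQuadratic_le_exp {b x y : ℝ} (hb : 0 < b) (hx : |x| ≤ y) :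
    ‖(expQuadratic b).eval (x : ℂ)‖ ≤ Real.exp (y ^ 4 / (8 * b ^ 4)) := by
  refine le_of_sq_le_sq ?_ (Real.exp_pos _).le
  have hx4 : x ^ 4 ≤ y ^ 4 := by
    calc x ^ 4 = |x| ^ 4 := by rw [← abs_pow, abs_of_nonneg (by positivity)]
      _ ≤ y ^ 4 := by gcongr
  rw [sq_norm_eval_expQuadratic hb, ← Real.exp_nat_mul]
  calc 1 + x ^ 4 / (4 * b ^ 4) ≤ y ^ 4 / (4 * b ^ 4) + 1 := by rw [add_comm]; gcongr
    _ ≤ Real.exp (y ^ 4 / (4 * b ^ 4)) := Real.add_one_le_exp _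
    _ = _ := by congr 1; push_cast; ring

end QuadraticFactor

section ZeroCount

/-- The integer part of a small multiple of the `k`-th increment of `f`. -/
noncomputable def stepFloor (f : ℕ → ℝ) (k : ℕ) : ℕ := ⌊(f (k + 1) - f k) / 22⌋₊

/-- The increments of `stepFloor`. -/
noncomputable def zeroCount (f : ℕ → ℝ) : ℕ → ℕ
  | 0 => stepFloor f 0
  | k + 1 => stepFloor f (k + 1) - stepFloor f k

variable {f : ℕ → ℝ}

/-- Monotone increments make the truncated subtraction genuine, so the sum telescopes. -/
lemma sum_zeroCount (hd : Monotone fun k => f (k + 1) - f k) (m : ℕ) :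
    ∑ k ∈ Finset.range (m + 1), zeroCount f k = stepFloor f m := by
  induction m with
  | zero => simp [zeroCount]
  | succ m ih =>
    have hle : stepFloor f m ≤ stepFloor f (m + 1) :=
      Nat.floor_mono (div_le_div_of_nonneg_right (hd m.le_succ) (by norm_num))
    rw [Finset.sum_range_succ, ih, zeroCount]
    omega

lemma zeroCount_le (f : ℕ → ℝ) (k : ℕ) : zeroCount f k ≤ stepFloor f k := by
  cases k with
  | zero => exact le_rfl
  | succ k => exact Nat.sub_le _ _

lemma stepFloor_le (hf : Monotone f) (k : ℕ) :
    (stepFloor f k : ℝ) ≤ (f (k + 1) - f k) / 22 :=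
  Nat.floor_le (div_nonneg (sub_nonneg.2 (hf k.le_succ)) (by norm_num))

/-- Summation by parts. The weight `j + 1 - k` counts the dyadic scales between a factor and `x`,
hence its logarithmic size there. -/
lemma sum_zeroCount_mul_sub (hd : Monotone fun k => f (k + 1) - f k) (j : ℕ) :
    ∑ k ∈ Finset.range (j + 1), (zeroCount f k : ℝ) * ((j + 1 - k : ℕ) : ℝ) =
      ∑ k ∈ Finset.range (j + 1), (stepFloor f k : ℝ) := by
  induction j with
  | zero => simp [zeroCount]
  | succ j ih =>
    rw [Finset.sum_range_succ _ (j + 1),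
      Finset.sum_range_succ (fun k => (stepFloor f k : ℝ)) (j + 1), ← ih,
      ← sum_zeroCount hd (j + 1), Finset.sum_range_succ _ (j + 1)]
    push_cast
    rw [← add_assoc, ← Finset.sum_add_distrib]
    congr 1
    · refine Finset.sum_congr rfl fun k hk => ?_
      have hk' := Nat.lt_succ_iff.1 (Finset.mem_range.1 hk)
      have : j + 1 + 1 - k = (j + 1 - k) + 1 := by omega
      rw [this]
      push_cast
      ring
    · simp

lemma sum_zeroCount_div (hd : Monotone fun k => f (k + 1) - f k) (m : ℕ) :
    ∑ k ∈ Finset.range (m + 1), (zeroCount f k : ℝ) / 2 ^ k =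
      ∑ k ∈ Finset.range m, (stepFloor f k : ℝ) / 2 ^ (k + 1) + stepFloor f m / 2 ^ m := by
  induction m with
  | zero => simp [zeroCount]
  | succ m ih =>
    have h1 : (zeroCount f (m + 1) : ℝ) = stepFloor f (m + 1) - stepFloor f m := by
      have h := Finset.sum_range_succ (zeroCount f) (m + 1)
      rw [sum_zeroCount hd, sum_zeroCount hd] at h
      rw [h]
      push_cast
      ring
    rw [Finset.sum_range_succ, ih, h1, Finset.sum_range_succ, pow_succ]
    field_simp
    ring

/-- Rounding down loses at most `∑ 2^(-(k+1)) ≤ 1` in total. -/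
lemma le_sum_zeroCount_div (hd : Monotone fun k => f (k + 1) - f k) (m : ℕ) :
    (∑ k ∈ Finset.range m, (f (k + 1) - f k) / 2 ^ k) / 44 - 1 ≤
      ∑ k ∈ Finset.range m, (zeroCount f k : ℝ) / 2 ^ k := by
  have hgeom : ∀ m : ℕ, ∑ k ∈ Finset.range m, (1 : ℝ) / 2 ^ (k + 1) ≤ 1 := fun m => by
    have : ∑ k ∈ Finset.range m, (1 : ℝ) / 2 ^ (k + 1) = 1 - 1 / 2 ^ m := by
      induction m with
      | zero => simp
      | succ m ih => rw [Finset.sum_range_succ, ih, pow_succ]; field_simp; ring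
    rw [this]
    linarith [show (0 : ℝ) < 1 / 2 ^ m by positivity]
  have hν : ∑ k ∈ Finset.range m, (stepFloor f k : ℝ) / 2 ^ (k + 1) ≤
      ∑ k ∈ Finset.range m, (zeroCount f k : ℝ) / 2 ^ k := by
    cases m with
    | zero => simp
    | succ m =>
      rw [sum_zeroCount_div hd, Finset.sum_range_succ]
      gcongr
      · exact one_le_two
      · exact m.le_succ
  refine le_trans ?_ hν
  have hterm : ∀ k ∈ Finset.range m, (f (k + 1) - f k) / 2 ^ k / 44 - 1 / 2 ^ (k + 1) ≤
      (stepFloor f k : ℝ) / 2 ^ (k + 1) := fun k _ => by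
    have := (Nat.lt_floor_add_one ((f (k + 1) - f k) / 22)).le
    have h2 : (f (k + 1) - f k) / 22 - 1 ≤ (stepFloor f k : ℝ) := by
      rw [stepFloor]; linarith
    calc (f (k + 1) - f k) / 2 ^ k / 44 - 1 / 2 ^ (k + 1)
        = ((f (k + 1) - f k) / 22 - 1) / 2 ^ (k + 1) := by rw [pow_succ]; field_simp; ring
      _ ≤ _ := by gcongr
  refine le_trans ?_ (Finset.sum_le_sum hterm)
  rw [Finset.sum_sub_distrib, ← Finset.sum_div]
  linarith [hgeom m]

/-- The product of the polynomials `expQuadratic (b k) ^ zeroCount f k`. -/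
noncomputable def dyadicProduct (f b : ℕ → ℝ) (m : ℕ) : Polynomial ℂ :=
  ∏ k ∈ Finset.range m, expQuadratic (b k) ^ zeroCount f k

lemma natDegree_dyadicProduct_le (hf : Monotone f) (hf0 : 0 ≤ f 0)
    (hd : Monotone fun k => f (k + 1) - f k) (b : ℕ → ℝ) (m : ℕ) :
    ((dyadicProduct f b m).natDegree : ℝ) ≤ f m := by
  cases m with
  | zero => simpa [dyadicProduct] using hf0
  | succ m =>
    have h1 : (dyadicProduct f b (m + 1)).natDegree ≤ 2 * stepFloor f m := by
      rw [← sum_zeroCount hd m, Finset.mul_sum]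
      refine (Polynomial.natDegree_prod_le _ _).trans (Finset.sum_le_sum fun k _ => ?_)
      refine Polynomial.natDegree_pow_le.trans ?_
      rw [mul_comm]
      exact Nat.mul_le_mul_right _ (natDegree_expQuadratic_le _)
    have h2 : ((dyadicProduct f b (m + 1)).natDegree : ℝ) ≤ 2 * stepFloor f m := by
      exact_mod_cast h1
    have := stepFloor_le hf m
    linarith [hf (Nat.zero_le m), hf (Nat.zero_le (m + 1))]

/-- Factors with `k ≤ j` contribute at most `2 f(j+1) / 22 ≤ (8/22) f(j)` to the exponent. The
others form a geometric series of ratio `1/4` bounded by `(8/66) f(j)`. The total `(32/66) f(j)`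
lies below `f(j) / 2`, and 22 is the least integer divisor for which these estimates allow it. -/
lemma norm_eval_dyadicProduct_le (hf : Monotone f) (hf0 : 0 ≤ f 0)
    (hd : Monotone fun k => f (k + 1) - f k) (hf4 : ∀ k, f (k + 1) ≤ 4 * f k) {k₀ : ℕ}
    (m j : ℕ) {x : ℝ} (hx : |x| ≤ 2 ^ (k₀ + j + 1)) :
    ‖(dyadicProduct f (fun k => 2 ^ (k₀ + k)) m).eval (x : ℂ)‖ ≤ Real.exp (f j / 2) := by
  have hfn : ∀ k, 0 ≤ f k := fun k => hf0.trans (hf k.zero_le)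
  set w : ℕ → ℝ := fun k =>
    if k ≤ j then 2 * ((j + 1 - k : ℕ) : ℝ) else 16 ^ (j + 1) / (8 * 16 ^ k) with hw
  have hw0 : ∀ k, 0 ≤ w k := fun k => by simp only [hw]; split_ifs <;> positivity
  have hq : ∀ k, ‖(expQuadratic (2 ^ (k₀ + k))).eval (x : ℂ)‖ ≤ Real.exp (w k) := fun k => by
    simp only [hw]
    split_ifs with hk
    · have e : j + 1 - k = (j - k) + 1 := by omega
      rw [e]
      refine norm_expQuadratic_le_of_le (by positivity) (hx.trans (le_of_eq ?_))
      rw [← pow_add]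
      congr 1
      omega
    · refine (norm_expQuadratic_le_exp (by positivity) hx).trans (le_of_eq ?_)
      congr 1
      have e1 : ∀ i : ℕ, ((2 : ℝ) ^ i) ^ 4 = 16 ^ i := fun i => by
        rw [← pow_mul, mul_comm, pow_mul]; norm_num
      rw [e1, e1, add_assoc, pow_add, pow_add _ k₀ k]
      field_simp
  have hsum : ∑ k ∈ Finset.range m, (zeroCount f k : ℝ) * w k ≤ f j / 2 := by
    have hsub : ∑ k ∈ Finset.range m, (zeroCount f k : ℝ) * w k ≤
        ∑ k ∈ Finset.range (j + 1 + m), (zeroCount f k : ℝ) * w k :=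
      Finset.sum_le_sum_of_subset_of_nonneg (Finset.range_subset_range.2 (by omega))
        fun k _ _ => mul_nonneg (Nat.cast_nonneg _) (hw0 k)
    rw [Finset.sum_range_add] at hsub
    have h1 : ∑ k ∈ Finset.range (j + 1), (zeroCount f k : ℝ) * w k ≤ 8 / 22 * f j := by
      have e : ∑ k ∈ Finset.range (j + 1), (zeroCount f k : ℝ) * w k =
          2 * ∑ k ∈ Finset.range (j + 1), (zeroCount f k : ℝ) * ((j + 1 - k : ℕ) : ℝ) := by
        rw [Finset.mul_sum]
        refine Finset.sum_congr rfl fun k hk => ?_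
        simp only [hw, if_pos (Nat.lt_succ_iff.1 (Finset.mem_range.1 hk))]
        ring
      rw [e, sum_zeroCount_mul_sub hd]
      have h2 := Finset.sum_le_sum fun k (_ : k ∈ Finset.range (j + 1)) => stepFloor_le hf k
      rw [← Finset.sum_div, Finset.sum_range_sub] at h2
      linarith [hf4 j]
    have h4pow : ∀ i : ℕ, f (j + i) ≤ 4 ^ i * f j := fun i => by
      induction i with
      | zero => simp
      | succ i ih =>
        rw [← add_assoc, pow_succ]
        linarith [hf4 (j + i)]
    have h3 : ∀ m : ℕ, ∑ i ∈ Finset.range m, (zeroCount f (j + 1 + i) : ℝ) * w (j + 1 + i) ≤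
        (1 - 1 / 4 ^ m) * (8 / 66 * f j) := fun m => by
      induction m with
      | zero => simp
      | succ m ih =>
        rw [Finset.sum_range_succ]
        have hz : (zeroCount f (j + 1 + m) : ℝ) ≤ 4 ^ (m + 2) * f j / 22 := by
          have z1 : (zeroCount f (j + 1 + m) : ℝ) ≤ stepFloor f (j + 1 + m) := by
            exact_mod_cast zeroCount_le f _
          have z2 := stepFloor_le hf (j + 1 + m)
          have z3 := h4pow (m + 2)
          have e : j + 1 + m + 1 = j + (m + 2) := by omega
          rw [e] at z2
          linarith [hfn (j + 1 + m)]
        have hwv : w (j + 1 + m) = 1 / (8 * 16 ^ m) := by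
          simp only [hw]
          rw [if_neg (by omega), pow_add _ (j + 1) m]
          field_simp
        have hle : (zeroCount f (j + 1 + m) : ℝ) * w (j + 1 + m) ≤
            4 ^ (m + 2) * f j / 22 * (1 / (8 * 16 ^ m)) := by
          rw [hwv]; gcongr
        have e16 : (16 : ℝ) ^ m = 4 ^ m * 4 ^ m := by rw [← mul_pow]; norm_num
        have e : 4 ^ (m + 2) * f j / 22 * (1 / (8 * 16 ^ m)) = 1 / 4 ^ m * (f j / 11) := by
          rw [e16, pow_add]; field_simp; ring
        have e' : (1 : ℝ) / 4 ^ (m + 1) = 1 / 4 ^ m / 4 := by rw [pow_succ, div_div]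
        rw [e] at hle
        rw [e']
        linarith
    have h5 := h3 m
    have h6 : (1 - 1 / 4 ^ m) * (8 / 66 * f j) ≤ 8 / 66 * f j := by
      refine mul_le_of_le_one_left (by have := hfn j; positivity) ?_
      linarith [show (0 : ℝ) < 1 / 4 ^ m by positivity]
    linarith [hfn j]
  rw [dyadicProduct, Polynomial.eval_prod, norm_prod]
  calc ∏ k ∈ Finset.range m, ‖(expQuadratic (2 ^ (k₀ + k)) ^ zeroCount f k).eval (x : ℂ)‖
      ≤ ∏ k ∈ Finset.range m, Real.exp ((zeroCount f k : ℝ) * w k) := by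
        refine Finset.prod_le_prod (fun k _ => norm_nonneg _) fun k _ => ?_
        rw [Polynomial.eval_pow, norm_pow, Real.exp_nat_mul]
        exact pow_le_pow_left₀ (norm_nonneg _) (hq k) _
    _ = Real.exp (∑ k ∈ Finset.range m, (zeroCount f k : ℝ) * w k) := (Real.exp_sum _ _).symm
    _ ≤ _ := Real.exp_le_exp.2 hsum

lemma le_norm_eval_I_dyadicProduct (hd : Monotone fun k => f (k + 1) - f k) (k₀ m : ℕ) :
    Real.exp (((∑ k ∈ Finset.range m, (f (k + 1) - f k) / 2 ^ k) / 44 - 1) / 2 ^ (k₀ + 1)) ≤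
      ‖(dyadicProduct f (fun k => 2 ^ (k₀ + k)) m).eval Complex.I‖ := by
  rw [dyadicProduct, Polynomial.eval_prod, norm_prod]
  calc Real.exp (((∑ k ∈ Finset.range m, (f (k + 1) - f k) / 2 ^ k) / 44 - 1) / 2 ^ (k₀ + 1))
      ≤ Real.exp ((∑ k ∈ Finset.range m, (zeroCount f k : ℝ) / 2 ^ k) / 2 ^ (k₀ + 1)) := by
        gcongr
        exact le_sum_zeroCount_div hd m
    _ = ∏ k ∈ Finset.range m, Real.exp (zeroCount f k * (1 / (2 * 2 ^ (k₀ + k)))) := by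
        rw [← Real.exp_sum, Finset.sum_div]
        congr 1
        refine Finset.sum_congr rfl fun k _ => ?_
        rw [pow_succ, pow_add]
        field_simp
    _ ≤ _ := by
        refine Finset.prod_le_prod (fun k _ => (Real.exp_pos _).le) fun k _ => ?_
        rw [Polynomial.eval_pow, norm_pow, Real.exp_nat_mul]
        exact pow_le_pow_left₀ (Real.exp_pos _).le
          (exp_le_norm_eval_I_expQuadratic (one_le_pow₀ one_le_two)) _

end ZeroCount

namespace IsWeightExponent

variable {φ : ℝ → ℝ}

/-- Summation by parts turns the increments back into the dyadic sum for `I_n`; the tail `n /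
2^(k₀+m)` is absorbed by the boundary term since `n ≤ 4 φ(2^(k₀+m))`. -/
lemma truncatedIntegral_le_of_doubling (hφ : IsWeightExponent φ) {k₀ m n : ℕ}
    (hm : (n : ℝ) ≤ 4 * φ (2 ^ (k₀ + m))) :
    truncatedIntegral φ n ≤ 5 * φ (2 ^ k₀) + 4 / 2 ^ k₀ *
      ∑ k ∈ Finset.range m, (φ (2 ^ (k₀ + (k + 1))) - φ (2 ^ (k₀ + k))) / 2 ^ k := by
  have hpos : ∀ k : ℕ, 0 ≤ φ (2 ^ k) := fun k => hφ.nonneg _ (by positivity)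
  have h := hφ.truncatedIntegral_le n (k₀ + m)
  rw [Finset.sum_range_add] at h
  have h1 : ∀ k' ≤ k₀, ∑ k ∈ Finset.range k', min (φ (2 ^ (k + 1))) (n : ℝ) / 2 ^ (k + 1) ≤
      (1 - 1 / 2 ^ k') * φ (2 ^ k₀) := fun k' hk' => by
    induction k' with
    | zero => simp
    | succ k' ih =>
      rw [Finset.sum_range_succ]
      have hle : min (φ (2 ^ (k' + 1))) (n : ℝ) / 2 ^ (k' + 1) ≤ φ (2 ^ k₀) / 2 ^ (k' + 1) := by
        gcongr
        exact (min_le_left _ _).trans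
          (hφ.mono (by positivity) (pow_le_pow_right₀ one_le_two hk'))
      have e : (1 - 1 / 2 ^ k') * φ (2 ^ k₀) + φ (2 ^ k₀) / 2 ^ (k' + 1) =
          (1 - 1 / 2 ^ (k' + 1)) * φ (2 ^ k₀) := by rw [pow_succ]; field_simp; ring
      linarith [ih (by omega)]
  have h1' := h1 k₀ le_rfl
  have h1'' : (1 - 1 / 2 ^ k₀) * φ (2 ^ k₀) ≤ φ (2 ^ k₀) := by
    refine mul_le_of_le_one_left (hpos k₀) ?_
    linarith [show (0 : ℝ) < 1 / 2 ^ k₀ by positivity]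
  have h2 : ∀ m : ℕ,
      ∑ k ∈ Finset.range m, (φ (2 ^ (k₀ + (k + 1))) - φ (2 ^ (k₀ + k))) / 2 ^ k =
      ∑ k ∈ Finset.range m, φ (2 ^ (k₀ + (k + 1))) / 2 ^ (k + 1) + φ (2 ^ (k₀ + m)) / 2 ^ m -
        φ (2 ^ k₀) := fun m => by
    induction m with
    | zero => simp
    | succ m ih =>
      rw [Finset.sum_range_succ, ih, Finset.sum_range_succ, pow_succ (2 : ℝ) m]
      field_simp
      ring
  have h3 : ∑ k ∈ Finset.range m, min (φ (2 ^ (k₀ + k + 1))) (n : ℝ) / 2 ^ (k₀ + k + 1) ≤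
      1 / 2 ^ k₀ * ∑ k ∈ Finset.range m, φ (2 ^ (k₀ + (k + 1))) / 2 ^ (k + 1) := by
    rw [Finset.mul_sum]
    refine Finset.sum_le_sum fun k _ => ?_
    calc min (φ (2 ^ (k₀ + k + 1))) (n : ℝ) / 2 ^ (k₀ + k + 1)
        ≤ φ (2 ^ (k₀ + k + 1)) / 2 ^ (k₀ + k + 1) := by gcongr; exact min_le_left _ _
      _ = 1 / 2 ^ k₀ * (φ (2 ^ (k₀ + (k + 1))) / 2 ^ (k + 1)) := by
          rw [add_assoc, pow_add]; field_simp
  have h4 : (n : ℝ) / 2 ^ (k₀ + m) ≤ 4 / 2 ^ k₀ * (φ (2 ^ (k₀ + m)) / 2 ^ m) := by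
    calc (n : ℝ) / 2 ^ (k₀ + m) ≤ 4 * φ (2 ^ (k₀ + m)) / 2 ^ (k₀ + m) := by gcongr
      _ = _ := by rw [pow_add]; field_simp
  have h5 : 0 ≤ ∑ k ∈ Finset.range m, φ (2 ^ (k₀ + (k + 1))) / 2 ^ (k + 1) :=
    Finset.sum_nonneg fun k _ => div_nonneg (hpos _) (by positivity)
  rw [h2 m]
  have h6 : 4 / 2 ^ k₀ * φ (2 ^ k₀) ≤ 4 * φ (2 ^ k₀) := by
    refine mul_le_mul_of_nonneg_right ?_ (hpos k₀)
    exact div_le_self (by norm_num) (one_le_pow₀ one_le_two)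
  have h7 : 0 ≤ (3 : ℝ) / 2 ^ k₀ := by positivity
  have h8 := mul_nonneg h7 h5
  have e9 : 4 / 2 ^ k₀ * (∑ k ∈ Finset.range m, φ (2 ^ (k₀ + (k + 1))) / 2 ^ (k + 1) +
      φ (2 ^ (k₀ + m)) / 2 ^ m - φ (2 ^ k₀)) =
      3 / 2 ^ k₀ * (∑ k ∈ Finset.range m, φ (2 ^ (k₀ + (k + 1))) / 2 ^ (k + 1)) +
      1 / 2 ^ k₀ * (∑ k ∈ Finset.range m, φ (2 ^ (k₀ + (k + 1))) / 2 ^ (k + 1)) +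
      4 / 2 ^ k₀ * (φ (2 ^ (k₀ + m)) / 2 ^ m) - 4 / 2 ^ k₀ * φ (2 ^ k₀) := by ring
  rw [e9]
  linarith

theorem hasLargePolynomials_of_normal (hφ : IsWeightExponent φ) (h : NormallyGrowing φ) :
    HasLargePolynomials φ := by
  obtain ⟨A, hA, hanti, hconv⟩ := h
  obtain ⟨k₀, hk₀⟩ := pow_unbounded_of_one_lt A (one_lt_two : (1 : ℝ) < 2)
  set f : ℕ → ℝ := fun k => φ (2 ^ (k₀ + k)) with hf
  have hAk : ∀ k : ℕ, A ≤ 2 ^ (k₀ + k) := fun k =>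
    hk₀.le.trans (pow_le_pow_right₀ one_le_two (Nat.le_add_right _ _))
  have hfm : Monotone f := fun i j hij =>
    hφ.mono (by positivity) (pow_le_pow_right₀ one_le_two (by omega))
  have hf0 : 0 ≤ f 0 := hφ.nonneg _ (by positivity)
  have hf4 : ∀ k, f (k + 1) ≤ 4 * f k := fun k => by
    have := hanti (mem_Ici.2 (hAk k)) (mem_Ici.2 (hAk (k + 1)))
      (pow_le_pow_right₀ one_le_two (by omega))
    simp only at this
    rw [div_le_div_iff₀ (by positivity) (by positivity)] at this
    have hp : (0 : ℝ) < (2 ^ (k₀ + k)) ^ 2 := by positivity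
    have e : ((2 : ℝ) ^ (k₀ + (k + 1))) ^ 2 = 4 * (2 ^ (k₀ + k)) ^ 2 := by
      rw [← add_assoc, pow_succ]; ring
    rw [e] at this
    have h2 : φ (2 ^ (k₀ + (k + 1))) * (2 ^ (k₀ + k)) ^ 2 ≤
        (4 * φ (2 ^ (k₀ + k))) * (2 ^ (k₀ + k)) ^ 2 := by linarith
    exact le_of_mul_le_mul_right h2 hp
  -- Midpoint convexity at `log 2^(k₀+k)` and `log 2^(k₀+k+2)`.
  have hd : Monotone fun k => f (k + 1) - f k := by
    refine monotone_nat_of_le_succ fun k => ?_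
    have hlog : ∀ i : ℕ, Real.log (2 ^ (k₀ + i)) ∈ Ici (Real.log A) := fun i =>
      Real.log_le_log hA (hAk i)
    have hconv' := hconv.2
    have := hconv' (hlog k) (hlog (k + 2)) (show (0 : ℝ) ≤ 1 / 2 by norm_num)
      (show (0 : ℝ) ≤ 1 / 2 by norm_num) (by norm_num)
    have e : (1 / 2 : ℝ) • Real.log (2 ^ (k₀ + k)) + (1 / 2 : ℝ) • Real.log (2 ^ (k₀ + (k + 2))) =
        Real.log (2 ^ (k₀ + (k + 1))) := by
      simp only [Real.log_pow, smul_eq_mul]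
      push_cast
      ring
    rw [e] at this
    simp only [Real.exp_log (show (0 : ℝ) < 2 ^ _ by positivity), smul_eq_mul] at this
    simp only [hf]
    have e1 : k₀ + (k + 1 + 1) = k₀ + (k + 2) := by omega
    rw [e1]
    linarith
  obtain ⟨N, hN⟩ := exists_nat_ge (f 0)
  -- `352 = 44 * 2 * 4`: the rounding lemma, the bound `exp(1 / (2b))` at `i`, and the factor `4 / 2
  -- ^ k₀` in the estimate of `I_n`.
  set c : ℝ := 1 / 352 with hc
  refine ⟨c, by norm_num, 1 + f 0, N, fun n hn => ?_⟩
  have hn0 : f 0 ≤ n := hN.trans (by exact_mod_cast hn)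
  obtain ⟨K, hK1, hK2⟩ := hφ.exists_dyadic
    ((hφ.mono zero_le_one (one_le_pow₀ one_le_two)).trans hn0)
  have hkK : k₀ ≤ K := by
    by_contra hcon
    have := hφ.mono (by positivity)
      (pow_le_pow_right₀ (one_le_two (α := ℝ)) (show K + 1 ≤ k₀ + 0 by omega))
    linarith
  obtain ⟨m, rfl⟩ := Nat.exists_eq_add_of_le hkK
  refine ⟨dyadicProduct f (fun k => 2 ^ (k₀ + k)) m, ?_, fun x => ?_, ?_⟩
  · have := natDegree_dyadicProduct_le hfm hf0 hd (fun k => 2 ^ (k₀ + k)) m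
    exact_mod_cast this.trans hK1
  · rcases le_total |x| (2 ^ (k₀ + 0)) with hx | hx
    · refine (norm_eval_dyadicProduct_le hfm hf0 hd hf4 m 0 (hx.trans ?_)).trans ?_
      · exact pow_le_pow_right₀ one_le_two (by omega)
      · have := hφ.nonneg |x| (abs_nonneg x)
        exact Real.exp_le_exp.2 (by linarith)
    · obtain ⟨i, hi1, hi2⟩ := exists_nat_pow_near
        ((one_le_pow₀ one_le_two).trans hx) (one_lt_two : (1 : ℝ) < 2)
      have hki : k₀ ≤ i := by
        by_contra hcon
        have := pow_le_pow_right₀ (one_le_two (α := ℝ)) (show i + 1 ≤ k₀ + 0 by omega)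
        linarith
      obtain ⟨j, rfl⟩ := Nat.exists_eq_add_of_le hki
      refine (norm_eval_dyadicProduct_le hfm hf0 hd hf4 m j hi2.le).trans ?_
      have : f j ≤ φ |x| := hφ.mono (by positivity) hi1
      exact Real.exp_le_exp.2 (by linarith)
  · refine le_trans (Real.exp_le_exp.2 ?_) (le_norm_eval_I_dyadicProduct hd k₀ m)
    have h1 := hφ.truncatedIntegral_le_of_doubling (k₀ := k₀) (m := m) (n := n)
      (hK2.le.trans (hf4 m))
    set D := ∑ k ∈ Finset.range m, (f (k + 1) - f k) / 2 ^ k with hD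
    have e : ((D / 44 - 1) / 2 ^ (k₀ + 1) : ℝ) = c * (4 / 2 ^ k₀ * D) - 1 / 2 ^ (k₀ + 1) := by
      rw [hc, pow_succ]; field_simp; ring
    have h2 : (1 : ℝ) / 2 ^ (k₀ + 1) ≤ 1 :=
      div_le_self zero_le_one (one_le_pow₀ one_le_two)
    have h3 : truncatedIntegral φ n ≤ 5 * f 0 + 4 / 2 ^ k₀ * D := h1
    have h4 : c * truncatedIntegral φ n ≤ c * (5 * f 0 + 4 / 2 ^ k₀ * D) := by gcongr
    have h5 : c * (5 * f 0) ≤ f 0 := by rw [hc]; linarith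
    rw [e]
    linarith

end IsWeightExponent

end WeightedApprox

/-! ### The upper bound for `E_n` and the conclusion -/

namespace WeightedApprox

namespace IsWeightExponent

variable {φ : ℝ → ℝ}

theorem hasLargePolynomials (hφ : IsWeightExponent φ) (hreg : RegularlyGrowing φ) :
    HasLargePolynomials φ :=
  hreg.elim hφ.hasLargePolynomials_of_normal hφ.hasLargePolynomials_of_rapid

theorem exists_cauchyError_le (hφ : IsWeightExponent φ) (h : HasLargePolynomials φ) :
    ∃ c : ℝ, 0 < c ∧ ∃ N : ℕ, ∀ p : ℝ≥0∞, 1 ≤ p → ∀ n : ℕ, N ≤ n →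
      cauchyError p (weight φ) n ≤ ENNReal.ofReal (Real.exp (-(c * truncatedIntegral φ n))) := by
  obtain ⟨c, hc, B, N, hN⟩ := h
  obtain ⟨D, hD, hsq⟩ := hφ.exists_one_add_sq_le
  obtain ⟨N', hN'⟩ := (hφ.tendsto_truncatedIntegral.eventually_ge_atTop
    ((Real.log (D * Real.pi) + 2 * B) / (c / 2))).exists_forall_of_atTop
  -- Half of `c I_n` is given up to absorb `D π e^{2B}`.
  refine ⟨c / 2, by positivity, max N N', fun p hp n hn => ?_⟩
  obtain ⟨P, hP, hPx, hPI⟩ := hN n (le_of_max_le_left hn)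
  have hlarge := hN' n (le_of_max_le_right hn)
  rw [div_le_iff₀ (by positivity)] at hlarge
  have hPI0 : 0 < ‖P.eval Complex.I‖ := (Real.exp_pos _).trans_le hPI
  have hb : ∀ x : ℝ, ‖P.eval (x : ℂ)‖ * (1 + x ^ 2) ≤ D * Real.exp B * weight φ x := fun x => by
    calc ‖P.eval (x : ℂ)‖ * (1 + x ^ 2)
        ≤ Real.exp (B + φ |x| / 2) * (D * Real.exp (φ |x| / 2)) :=
          mul_le_mul (hPx x) (hsq x) (by positivity) (Real.exp_pos _).le
      _ = D * (Real.exp (B + φ |x| / 2) * Real.exp (φ |x| / 2)) := by ring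
      _ = D * Real.exp B * weight φ x := by
          rw [weight, mul_assoc, ← Real.exp_add, ← Real.exp_add]
          ring_nf
  refine (cauchyError_le_of_polynomial hp (fun x => Real.exp_pos _) hP (norm_pos_iff.1 hPI0)
    (by positivity) hb).trans (ENNReal.ofReal_le_ofReal ?_)
  have hDpi : 0 < D * Real.pi := by positivity
  calc D * Real.exp B / ‖P.eval Complex.I‖ * Real.pi
      ≤ D * Real.exp B / Real.exp (c * truncatedIntegral φ n - B) * Real.pi := by gcongr
    _ = Real.exp (Real.log (D * Real.pi)) *
          (Real.exp B / Real.exp (c * truncatedIntegral φ n - B)) := by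
        rw [Real.exp_log hDpi]; ring
    _ = Real.exp (Real.log (D * Real.pi) + (B - (c * truncatedIntegral φ n - B))) := by
        rw [← Real.exp_sub, ← Real.exp_add]
    _ ≤ _ := Real.exp_le_exp.2 (by linarith)

end IsWeightExponent

end WeightedApprox

/-- Two-sided logarithmic estimate for the error of weighted polynomial approximation of the Cauchy
kernel: for large `n` with constants depending only on `φ`, and, for each fixed `p`, for all
`n ≥ 1` for which `log E_n(p, W)` is negative. -/
theorem theorem1 (φ : ℝ → ℝ) (hφ : WeightedApprox.IsWeightExponent φ)
    (hreg : WeightedApprox.RegularlyGrowing φ) :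
    (∃ C : ℝ, 0 < C ∧ ∃ N : ℕ, ∀ p : ℝ≥0∞, 1 ≤ p → ∀ n : ℕ, N ≤ n →
      0 < WeightedApprox.cauchyError p (WeightedApprox.weight φ) n ∧
      WeightedApprox.cauchyError p (WeightedApprox.weight φ) n < 1 ∧
      -(C * WeightedApprox.truncatedIntegral φ n) ≤
        Real.log (WeightedApprox.cauchyError p (WeightedApprox.weight φ) n).toReal ∧
      Real.log (WeightedApprox.cauchyError p (WeightedApprox.weight φ) n).toReal ≤
        -(C⁻¹ * WeightedApprox.truncatedIntegral φ n)) ∧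
    (∀ p : ℝ≥0∞, 1 ≤ p → ∃ C : ℝ, 0 < C ∧ ∀ n : ℕ, 1 ≤ n →
      0 < WeightedApprox.cauchyError p (WeightedApprox.weight φ) n ∧
      (WeightedApprox.cauchyError p (WeightedApprox.weight φ) n < 1 →
        -(C * WeightedApprox.truncatedIntegral φ n) ≤
          Real.log (WeightedApprox.cauchyError p (WeightedApprox.weight φ) n).toReal ∧
        Real.log (WeightedApprox.cauchyError p (WeightedApprox.weight φ) n).toReal ≤
          -(C⁻¹ * WeightedApprox.truncatedIntegral φ n))) := by
  obtain ⟨N₁, hlow⟩ := hφ.exists_cauchyError_ge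
  obtain ⟨c, hc, N₂, hup⟩ := hφ.exists_cauchyError_le (hφ.hasLargePolynomials hreg)
  set E := WeightedApprox.cauchyError
  set W := WeightedApprox.weight φ
  set I := WeightedApprox.truncatedIntegral φ
  have hI : ∀ n : ℕ, 1 ≤ n → 0 < I n := fun n hn => hφ.truncatedIntegral_pos hn
  set N := max (max N₁ N₂) 1 with hN
  set C := max 21 c⁻¹ with hC
  have hC0 : 0 < C := lt_of_lt_of_le (by norm_num) (le_max_left _ _)
  have hCc : C⁻¹ ≤ c := inv_le_of_inv_le₀ hc (le_max_right _ _)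
  -- The errors decrease in `n`, so the bound at `max n N₁` gives positivity for small `n` too.
  have hpos : ∀ p : ℝ≥0∞, 1 ≤ p → ∀ n : ℕ, 0 < E p W n := fun p hp n =>
    (ENNReal.ofReal_pos.2 (Real.exp_pos _)).trans_le
      ((hlow p hp (max n N₁) (le_max_right _ _)).trans
        (WeightedApprox.cauchyError_antitone p W (le_max_left n N₁)))
  have hmain : ∀ p : ℝ≥0∞, 1 ≤ p → ∀ n : ℕ, N ≤ n → E p W n < 1 ∧
      -(C * I n) ≤ Real.log (E p W n).toReal ∧ Real.log (E p W n).toReal ≤ -(C⁻¹ * I n) := by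
    intro p hp n hn
    have hn1 : 1 ≤ n := (le_max_right _ _).trans hn
    have hIn := hI n hn1
    have h1 := hlow p hp n (by omega)
    have h2 := hup p hp n (by omega)
    have hlt : E p W n < 1 := by
      refine h2.trans_lt ?_
      rw [ENNReal.ofReal_lt_one, Real.exp_lt_one_iff, neg_lt_zero]
      positivity
    have hfin : E p W n ≠ ∞ := hlt.ne_top
    have hpos' : 0 < (E p W n).toReal := ENNReal.toReal_pos (hpos p hp n).ne' hfin
    refine ⟨hlt, ?_, ?_⟩
    · rw [Real.le_log_iff_exp_le hpos']
      refine le_trans (Real.exp_le_exp.2 ?_) ((ENNReal.ofReal_le_iff_le_toReal hfin).1 h1)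
      have : 21 * I n ≤ C * I n := by gcongr; exact le_max_left _ _
      linarith
    · rw [Real.log_le_iff_le_exp hpos']
      refine (ENNReal.toReal_le_of_le_ofReal (Real.exp_pos _).le h2).trans
        (Real.exp_le_exp.2 ?_)
      have : C⁻¹ * I n ≤ c * I n := by gcongr
      linarith
  refine ⟨⟨C, hC0, N, fun p hp n hn => ⟨hpos p hp n, hmain p hp n hn⟩⟩, fun p hp => ?_⟩
  -- Adding both ratios for the finitely many `n < N` to `C` makes one constant serve them all;
  -- indices with error at least one only add harmless nonnegative terms.
  set g : ℕ → ℝ := fun n =>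
    |Real.log (E p W n).toReal| / |I n| + |I n| / |Real.log (E p W n).toReal| with hg
  have hg0 : ∀ n, 0 ≤ g n := fun n => by positivity
  have hsum : 0 ≤ ∑ k ∈ Finset.range N, g k := Finset.sum_nonneg fun k _ => hg0 k
  set C' := C + ∑ k ∈ Finset.range N, g k with hC'
  have hCC' : C ≤ C' := le_add_of_nonneg_right hsum
  have hC'0 : 0 < C' := hC0.trans_le hCC'
  refine ⟨C', hC'0, fun n hn => ⟨hpos p hp n, fun hlt => ?_⟩⟩
  have hIn := hI n hn
  rcases le_or_gt N n with hNn | hNn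
  · obtain ⟨-, h1, h2⟩ := hmain p hp n hNn
    have h3 : C * I n ≤ C' * I n := by gcongr
    have h4 : C'⁻¹ * I n ≤ C⁻¹ * I n := by gcongr
    exact ⟨by linarith, by linarith⟩
  · have hgn : g n ≤ C' := by
      have := Finset.single_le_sum (fun k _ => hg0 k) (Finset.mem_range.2 hNn)
      linarith
    have hpos' : 0 < (E p W n).toReal := ENNReal.toReal_pos (hpos p hp n).ne' hlt.ne_top
    have hlog : Real.log (E p W n).toReal < 0 := by
      refine Real.log_neg hpos' ?_
      rw [← ENNReal.toReal_one]
      exact (ENNReal.toReal_lt_toReal hlt.ne_top ENNReal.one_ne_top).2 hlt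
    simp only [hg, abs_of_neg hlog, abs_of_pos hIn] at hgn
    set l := Real.log (E p W n).toReal
    have hl : 0 < -l := by linarith
    have h1 : -l / I n ≤ C' := by linarith [div_pos hIn hl]
    have h2 : I n / -l ≤ C' := by linarith [div_pos hl hIn]
    rw [div_le_iff₀ hIn] at h1
    rw [div_le_iff₀ hl] at h2
    refine ⟨by linarith, ?_⟩
    have : C'⁻¹ * I n ≤ -l := by rwa [inv_mul_le_iff₀ hC'0]
    linarith
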